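/- **Model.** A bidder with budget $B$ takes part in $T$ rounds of second price auctions on $m$ platforms. The admissible bids form a finite set $\mathcal B\subset[0,1]$. In round $t$ the bidder chooses a bid vector $b_t\in\mathcal B^m$; then, independently over rounds and platforms, a critical bid $p_t(i)\in[0,1]$ and, independently of it, a value $v_t(i)\in[0,1]$ are drawn for each platform $i$ from fixed distributions unknown to the bidder. If $b_t(i)\ge p_t(i)$, platform $i$ is won: the bidder pays $p_t(i)$, gains $v_t(i)$ and observes both; otherwise the bidder pays and gains nothing on platform $i$ and learns only that $b_t(i)<p_t(i)$. An algorithm chooses $b_t$, possibly at random, from its own past bids and observations. Let $\tau$ be the first round at which the total cost so far exceeds $B$ (and $\tau=T+1$ if there is none); the algorithm collects the rewards of the rounds before $\tau$. Let $OPT$ be the supremum of the expected total reward over all bidding strategies for the given distributions, and let the regret of an algorithm be $OPT$ minus its expected total reward. **Theorem.** There is an absolute constant $c>0$ such that the following holds. Let $m\ge2$, let $B\ge m$ be such that $T=2B$ is an integer, let $\varepsilon=\sqrt{m/B}$, and let $\mathcal B\subset[0,1]$ be any finite bid set containing a bid $<1/2$ and a bid $\ge1/2$. For $j\in\{1,\dots,m\}$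 let $\mathcal I_j$ be the instance with $m$ platforms, budget $B$ and horizon $T$ in which every critical bid equals $1/2$ (so each win costs $1/2$), and the values are Bernoulli with mean $\tfrac12(1+\varepsilon)$ on platform $j$ and mean $\tfrac12$ on every other platform. Then $OPT(\mathcal I_j)=(1+\varepsilon)B=:OPT$ for every $j$, and every algorithm has expected regret at least $c\sqrt{m\,OPT}$ on the random instance $\mathcal I_j$ with $j$ uniform in $\{1,\dots,m\}$: $$\frac1m\sum_{j=1}^m \mathrm{Regret}_{\mathcal I_j}\ \ge\ c\,\sqrt{m\,OPT}.$$ In particular, for every algorithm there is a $j$ such that its regret on $\mathcal I_j$ is at least $c\sqrt{m\,OPT(\mathcal I_j)}$. -/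

import Mathlib

open MeasureTheory ProbabilityTheory

noncomputable section

/-- A stochastic instance of budgeted bidding in second price auctions on `m` platforms, over
`T` rounds, with a finite set `bidSet ⊆ [0, 1]` of admissible bids. In every round platform `i`
draws a critical bid from `priceLaw i` and, independently, a value from `valueLaw i`; all draws
are independent over platforms and rounds. -/
structure BiddingInstance (m T : ℕ) (bidSet : Finset ℝ) where
  bidSet_subset : ∀ b ∈ bidSet, b ∈ Set.Icc (0 : ℝ) 1
  budget : ℝ
  budget_nonneg : 0 ≤ budget
  priceLaw : Fin m → Measure ℝ
  valueLaw : Fin m → Measure ℝ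
  priceLaw_prob : ∀ i, IsProbabilityMeasure (priceLaw i)
  valueLaw_prob : ∀ i, IsProbabilityMeasure (valueLaw i)
  priceLaw_mem : ∀ i, ∀ᵐ p ∂(priceLaw i), p ∈ Set.Icc (0 : ℝ) 1
  valueLaw_mem : ∀ i, ∀ᵐ v ∂(valueLaw i), v ∈ Set.Icc (0 : ℝ) 1

attribute [instance] BiddingInstance.priceLaw_prob BiddingInstance.valueLaw_prob

/-- An arm: one admissible bid for each of the `m` platforms. -/
abbrev BidVector (m : ℕ) (bidSet : Finset ℝ) : Type := Fin m → bidSet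

/-- What the bidder learns in one round. The entry of platform `i` is `(true, p, v)` if the
auction was won at price `p` with realized value `v`, and `(false, 0, 0)` if it was lost. -/
abbrev Feedback (m : ℕ) : Type := Fin m → Bool × ℝ × ℝ

/-- One round of the interaction, as recorded by the bidder: the bid vector and the feedback. -/
abbrev RoundRecord (m : ℕ) (bidSet : Finset ℝ) : Type := BidVector m bidSet × Feedback m

/-- The feedback on bid vector `b` when platform `i` has critical bid `(x i).1` and value
`(x i).2`: the auction on platform `i` is won if and only if `b i ≥ (x i).1`. -/
def feedback {m : ℕ} {bidSet : Finset ℝ} (b : BidVector m bidSet) (x : Fin m → ℝ × ℝ) :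
    Feedback m :=
  fun i => if (x i).1 ≤ (b i : ℝ) then (true, (x i).1, (x i).2) else (false, 0, 0)

/-- The reward of a round: the sum of the values on the platforms that were won. -/
def roundReward {m : ℕ} (y : Feedback m) : ℝ := ∑ i, if (y i).1 then (y i).2.2 else 0

/-- The cost of a round: the sum of the prices on the platforms that were won. -/
def roundCost {m : ℕ} (y : Feedback m) : ℝ := ∑ i, if (y i).1 then (y i).2.1 else 0

/-- A (possibly randomized) bidding algorithm: in round `t` (counted from `0`) it draws its bid
vector from a distribution that depends measurably on the record of the rounds before `t`. -/
structure BiddingAlgorithm (m : ℕ) (bidSet : Finset ℝ) where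
  policy : (t : ℕ) → Kernel (Fin t → RoundRecord m bidSet) (BidVector m bidSet)
  policy_markov : ∀ t, IsMarkovKernel (policy t)

attribute [instance] BiddingAlgorithm.policy_markov

namespace BiddingInstance

variable {m T : ℕ} {bidSet : Finset ℝ}

/-- The joint law of the critical bids and values of all platforms in one round. -/
def outcomeLaw (I : BiddingInstance m T bidSet) : Measure (Fin m → ℝ × ℝ) :=
  Measure.pi fun i => (I.priceLaw i).prod (I.valueLaw i)

/-- The law of the feedback of one round, given the bid vector. -/
def feedbackKernel (I : BiddingInstance m T bidSet) :
    Kernel (BidVector m bidSet) (Feedback m) :=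
  Kernel.ofFunOfCountable fun b => I.outcomeLaw.map (feedback b)

/-- The law of the record of the first `t` rounds when algorithm `A` plays on instance `I`: given
the past, the algorithm draws a bid vector, and then fresh critical bids and values produce the
feedback. -/
def historyLaw (I : BiddingInstance m T bidSet) (A : BiddingAlgorithm m bidSet) :
    (t : ℕ) → Measure (Fin t → RoundRecord m bidSet)
  | 0 => Measure.dirac Fin.elim0
  | t + 1 =>
    ((I.historyLaw A t).compProd
      ((A.policy t).compProd (Kernel.prodMkLeft _ I.feedbackKernel))).map
      fun x => Fin.snoc (α := fun _ => RoundRecord m bidSet) x.1 x.2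

/-- With rounds numbered `1, …, T`, the first round `z` such that the total cost of rounds
`1, …, z` exceeds the budget, and `T + 1` if there is no such round. -/
def stoppingTime (I : BiddingInstance m T bidSet) (h : Fin T → RoundRecord m bidSet) : ℕ :=
  sInf ({T + 1} ∪ {z | z ∈ Set.Icc 1 T ∧
    I.budget < ∑ t : Fin T, if (t : ℕ) + 1 ≤ z then roundCost (h t).2 else 0})

/-- The total reward collected within the budget, that is, in the rounds before the stopping
time. -/
def totalReward (I : BiddingInstance m T bidSet) (h : Fin T → RoundRecord m bidSet) : ℝ :=
  ∑ t : Fin T, if (t : ℕ) + 1 < I.stoppingTime h then roundReward (h t).2 else 0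

/-- The expected total reward of algorithm `A` on instance `I`. -/
def expectedReward (I : BiddingInstance m T bidSet) (A : BiddingAlgorithm m bidSet) : ℝ :=
  ∫ h, I.totalReward h ∂(I.historyLaw A T)

/-- The performance of an optimal bidding strategy that knows the instance and may submit a new
bid vector in each round. -/
def opt (I : BiddingInstance m T bidSet) : ℝ :=
  ⨆ A : BiddingAlgorithm m bidSet, I.expectedReward A

/-- The regret of algorithm `A` on instance `I`. -/
def regret (I : BiddingInstance m T bidSet) (A : BiddingAlgorithm m bidSet) : ℝ :=
  I.opt - I.expectedReward A

end BiddingInstance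

/-- The boost parameter `ε = √(m / B)`. -/
def boost (m : ℕ) (B : ℝ) : ℝ := √(m / B)

theorem boost_mem {m : ℕ} {B : ℝ} (hB : (m : ℝ) ≤ B) : boost m B ∈ Set.Icc (0 : ℝ) 1 :=
  ⟨Real.sqrt_nonneg _, by
    unfold boost
    rw [Real.sqrt_le_left (by norm_num), one_pow]
    exact div_le_one_of_le₀ hB ((Nat.cast_nonneg m).trans hB)⟩

/-- The mean value of platform `i` when platform `j` is the boosted one. -/
def boostedMean {m : ℕ} {B : ℝ} (hB : (m : ℝ) ≤ B) (j i : Fin m) : unitInterval :=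
  ⟨if i = j then 1 / 2 * (1 + boost m B) else 1 / 2, by
    have h := boost_mem hB
    split_ifs
    · exact ⟨by linarith [h.1], by linarith [h.2]⟩
    · exact ⟨by norm_num, by norm_num⟩⟩

/-- The instance with budget `B` in which every platform has the deterministic critical bid `1 / 2`
and a Bernoulli value: of mean `(1 + ε) / 2` on platform `j` and `1 / 2` on the other platforms,
where `ε = √(m / B)`. -/
def boostedInstance {m : ℕ} (T : ℕ) {B : ℝ} (hB : (m : ℝ) ≤ B) {bidSet : Finset ℝ}
    (hbid : ∀ b ∈ bidSet, b ∈ Set.Icc (0 : ℝ) 1) (j : Fin m) : BiddingInstance m T bidSet where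
  bidSet_subset := hbid
  budget := B
  budget_nonneg := (Nat.cast_nonneg m).trans hB
  priceLaw := fun _ => Measure.dirac (1 / 2)
  valueLaw := fun i => bernoulliMeasure 1 0 (boostedMean hB j i)
  priceLaw_prob := fun _ => inferInstance
  valueLaw_prob := fun _ => inferInstance
  priceLaw_mem := fun _ => by
    rw [ae_dirac_eq]
    exact ⟨by norm_num, by norm_num⟩
  valueLaw_mem := fun i => by
    rw [ae_iff, bernoulliMeasure_def]
    simp [Set.indicator]

end

noncomputable section

open scoped ENNReal

variable {m T : ℕ} {B : ℝ} {bidSet : Finset ℝ}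

/-! Each win costs `1/2` and `T = 2B`, so the budget pays for exactly `T` wins, and the expected
reward is the expected number of paid wins weighted by the platform means. Spending all `T` wins on
the boosted platform gives `OPT`. If `N` is the number of paid wins on platform `j`, every algorithm
has regret at least `(ε/2)(T - E N)` on the `j`-th instance (`expectedReward_boostedInstance_le`,
`opt_boostedInstance`).

Means `1/2` and `(1+ε)/2` cannot be told apart from far fewer than `1/ε² = B/m` samples, and there
are `m` candidate platforms. A quota makes this precise: let `Q` be the event that platform `j` is
won more than `K` times while the total number of wins is at most `S`, with `K` about `B/(64m)` and
`S` about `3m(K+1)/4`. Off `Q`, at least `L = S - K` paid wins are missing from platform `j`, so the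
regret is at least `(ε/2) L P(not Q)` (`cappedWins_add_le`).

In the instance without a boost, at most `S/(K+1) ≤ 3m/4` platforms can exceed their quota, so `Q`
has average probability at most `3/4` over `j` (`sum_integral_exceedsQuota_le`). Whether `Q` occurs
is decided before the value of win number `K+1` on platform `j` is used, so its probability in the
boosted instance is its integral against the likelihood ratio `D` of the first `K` values on that
platform (`lintegral_exceedsQuota`). The second moment of `D` is at most `(1+ε²)^K ≤ 33/32`, hence
the boost adds at most `3/16` to the probability (`integral_exceedsQuota_le`). On average `Q` fails
with probability at least `1/16`. Since `L ≥ B/256`, the average regret is of order `εB = √(mB)`,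
which is of order `√(m OPT)`. -/

/-- The instance in which every critical bid is `1 / 2` and the value of platform `i` is Bernoulli
of mean `μ i`. -/
def bernoulliInstance {m : ℕ} (T : ℕ) {B : ℝ} (hB : 0 ≤ B) {bidSet : Finset ℝ}
    (hbid : ∀ b ∈ bidSet, b ∈ Set.Icc (0 : ℝ) 1) (μ : Fin m → unitInterval) :
    BiddingInstance m T bidSet where
  bidSet_subset := hbid
  budget := B
  budget_nonneg := hB
  priceLaw := fun _ => Measure.dirac (1 / 2)
  valueLaw := fun i => bernoulliMeasure 1 0 (μ i)
  priceLaw_prob := fun _ => inferInstance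
  valueLaw_prob := fun _ => inferInstance
  priceLaw_mem := fun _ => by
    rw [ae_dirac_eq]
    exact ⟨by norm_num, by norm_num⟩
  valueLaw_mem := fun i => by
    rw [ae_iff, bernoulliMeasure_def]
    simp [Set.indicator]

theorem boostedInstance_eq {m : ℕ} (T : ℕ) {B : ℝ} (hB : (m : ℝ) ≤ B) {bidSet : Finset ℝ}
    (hbid : ∀ b ∈ bidSet, b ∈ Set.Icc (0 : ℝ) 1) (j : Fin m) :
    boostedInstance T hB hbid j =
      bernoulliInstance T ((Nat.cast_nonneg m).trans hB) hbid (boostedMean hB j) := rfl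

/-! ### Laws of one round against critical bids `1/2`. -/

theorem lintegral_bernoulliMeasure_real (p : unitInterval) {f : ℝ → ℝ≥0∞} :
    ∫⁻ v, f v ∂(bernoulliMeasure 1 0 p) =
      ENNReal.ofReal p * f 1 + ENNReal.ofReal (1 - p) * f 0 := by
  rw [bernoulliMeasure_def, lintegral_add_measure]
  simp only [lintegral_smul_measure, lintegral_dirac]
  congr 1
  · rw [ENNReal.ofReal, Real.toNNReal_of_nonneg p.2.1]; rfl
  · rw [ENNReal.ofReal, Real.toNNReal_of_nonneg (by linarith [p.2.2])]; rfl

theorem lintegral_dirac_prod_bernoulliMeasure (p : unitInterval) {f : ℝ × ℝ → ℝ≥0∞}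
    (hf : Measurable f) :
    ∫⁻ a, f a ∂((Measure.dirac (1 / 2 : ℝ)).prod (bernoulliMeasure 1 0 p)) =
      ENNReal.ofReal p * f (1 / 2, 1) + ENNReal.ofReal (1 - p) * f (1 / 2, 0) := by
  rw [lintegral_prod _ hf.aemeasurable, lintegral_dirac, lintegral_bernoulliMeasure_real]

/-- Whether the bid on platform `i` wins against the critical bid `1 / 2`. -/
def winBid (i : Fin m) (b : BidVector m bidSet) : ℕ := if (1 / 2 : ℝ) ≤ b i then 1 else 0

theorem winBid_le_one (i : Fin m) (b : BidVector m bidSet) : winBid i b ≤ 1 := by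
  unfold winBid; split_ifs <;> simp

/-- The number of platforms won by a bid vector against critical bids `1 / 2`. -/
def winCount (b : BidVector m bidSet) : ℕ := ∑ i, winBid i b

theorem winBid_le_winCount (i : Fin m) (b : BidVector m bidSet) : winBid i b ≤ winCount b :=
  Finset.single_le_sum (f := fun i => winBid i b) (fun _ _ => Nat.zero_le _) (Finset.mem_univ i)

theorem measurable_feedback (b : BidVector m bidSet) : Measurable (feedback b) := by
  unfold feedback
  refine measurable_pi_iff.2 fun i => Measurable.ite ?_ (by fun_prop) (by fun_prop)
  exact measurableSet_le (by fun_prop) (by fun_prop)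

theorem measurable_roundReward : Measurable (roundReward (m := m)) := by
  unfold roundReward
  refine Finset.measurable_sum _ fun i _ => Measurable.ite ?_ (by fun_prop) (by fun_prop)
  exact (measurable_fst.comp (measurable_pi_apply i)) (measurableSet_singleton true)

instance (I : BiddingInstance m T bidSet) : IsProbabilityMeasure I.outcomeLaw := by
  unfold BiddingInstance.outcomeLaw; infer_instance

theorem feedbackKernel_apply (I : BiddingInstance m T bidSet) (b : BidVector m bidSet) :
    I.feedbackKernel b = I.outcomeLaw.map (feedback b) := rfl

instance (I : BiddingInstance m T bidSet) : IsMarkovKernel I.feedbackKernel :=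
  ⟨fun b => by
    rw [feedbackKernel_apply]
    exact Measure.isProbabilityMeasure_map (measurable_feedback b).aemeasurable⟩

theorem lintegral_feedbackKernel (I : BiddingInstance m T bidSet) (b : BidVector m bidSet)
    {f : Feedback m → ℝ≥0∞} (hf : Measurable f) :
    ∫⁻ y, f y ∂(I.feedbackKernel b) = ∫⁻ x, f (feedback b x) ∂I.outcomeLaw := by
  rw [feedbackKernel_apply, lintegral_map hf (measurable_feedback b)]

theorem lintegral_outcomeLaw_eval (hB : 0 ≤ B) (hbid : ∀ b ∈ bidSet, b ∈ Set.Icc (0 : ℝ) 1)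
    (μ : Fin m → unitInterval) (i : Fin m) {f : ℝ × ℝ → ℝ≥0∞} (hf : Measurable f) :
    ∫⁻ x, f (x i) ∂(bernoulliInstance T hB hbid μ).outcomeLaw =
      ENNReal.ofReal (μ i) * f (1 / 2, 1) + ENNReal.ofReal (1 - μ i) * f (1 / 2, 0) := by
  rw [← lintegral_dirac_prod_bernoulliMeasure _ hf]
  exact (measurePreserving_eval (μ := fun i => ((bernoulliInstance T hB hbid μ).priceLaw i).prod
    ((bernoulliInstance T hB hbid μ).valueLaw i)) i).lintegral_comp hf

/-- Records that can occur against critical bids `1 / 2` and values in `[0, 1]`. -/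
def ValidRecord (r : RoundRecord m bidSet) : Prop :=
  ∀ i, ((1 / 2 : ℝ) ≤ r.1 i ∧ (r.2 i).1 = true ∧ (r.2 i).2.1 = 1 / 2 ∧
      (r.2 i).2.2 ∈ Set.Icc (0 : ℝ) 1) ∨
    (¬ (1 / 2 : ℝ) ≤ r.1 i ∧ (r.2 i).1 = false)

theorem measurableSet_validRecord : MeasurableSet {r : RoundRecord m bidSet | ValidRecord r} := by
  have hwin (i : Fin m) : MeasurableSet {r : RoundRecord m bidSet | (1 / 2 : ℝ) ≤ r.1 i} :=
    measurableSet_le (by fun_prop) (by fun_prop)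
  have hflag (i : Fin m) (c : Bool) :
      MeasurableSet {r : RoundRecord m bidSet | (r.2 i).1 = c} :=
    (show Measurable fun r : RoundRecord m bidSet => (r.2 i).1 by fun_prop)
      (measurableSet_singleton c)
  have hprice (i : Fin m) : MeasurableSet {r : RoundRecord m bidSet | (r.2 i).2.1 = 1 / 2} :=
    (show Measurable fun r : RoundRecord m bidSet => (r.2 i).2.1 by fun_prop)
      (measurableSet_singleton _)
  have hval (i : Fin m) :
      MeasurableSet {r : RoundRecord m bidSet | (r.2 i).2.2 ∈ Set.Icc (0 : ℝ) 1} :=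
    (show Measurable fun r : RoundRecord m bidSet => (r.2 i).2.2 by fun_prop) measurableSet_Icc
  simp only [ValidRecord, Set.ofPred_forall]
  exact MeasurableSet.iInter fun i =>
    ((hwin i).inter ((hflag i true).inter ((hprice i).inter (hval i)))).union
      ((hwin i).compl.inter (hflag i false))

theorem ae_validRecord (hB : 0 ≤ B) (hbid : ∀ b ∈ bidSet, b ∈ Set.Icc (0 : ℝ) 1)
    (μ : Fin m → unitInterval) (b : BidVector m bidSet) :
    ∀ᵐ y ∂((bernoulliInstance T hB hbid μ).feedbackKernel b), ValidRecord (b, y) := by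
  set I := bernoulliInstance T hB hbid μ
  have hm : MeasurableSet {y : Feedback m | ValidRecord (b, y)} :=
    measurable_prodMk_left measurableSet_validRecord
  rw [feedbackKernel_apply, ae_map_iff (measurable_feedback b).aemeasurable hm]
  have hx : ∀ᵐ x ∂I.outcomeLaw, ∀ i, (x i).1 = 1 / 2 ∧ (x i).2 ∈ Set.Icc (0 : ℝ) 1 := by
    rw [ae_all_iff]
    intro i
    have hq := (measurePreserving_eval
      (μ := fun i => (I.priceLaw i).prod (I.valueLaw i)) i).quasiMeasurePreserving
    have h1 : ∀ᵐ a ∂(I.priceLaw i), a = 1 / 2 := by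
      change ∀ᵐ a ∂(Measure.dirac (1 / 2 : ℝ)), a = 1 / 2
      rw [ae_dirac_eq]; rfl
    have h1' := Measure.quasiMeasurePreserving_fst (μ := I.priceLaw i) (ν := I.valueLaw i) |>.ae h1
    have h2' := Measure.quasiMeasurePreserving_snd (μ := I.priceLaw i) (ν := I.valueLaw i) |>.ae
      (I.valueLaw_mem i)
    exact hq.ae (h1'.and h2')
  filter_upwards [hx] with x hx i
  by_cases h : (1 / 2 : ℝ) ≤ b i
  · left
    have := hx i
    simp only [feedback, this.1, h, if_true]
    exact ⟨trivial, trivial, trivial, this.2⟩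
  · right
    have := hx i
    simp only [feedback, this.1, h, if_false]
    exact ⟨not_false, trivial⟩

/-! ### Change of measure and moments of the likelihood ratio in one round. -/

/-- The likelihood ratio of one value `v ∈ {0, 1}` of the boosted platform. -/
def likelihoodRatio (ε v : ℝ) : ℝ≥0∞ := ENNReal.ofReal (1 + ε * (2 * v - 1))

theorem measurable_likelihoodRatio (ε : ℝ) : Measurable (likelihoodRatio ε) := by
  unfold likelihoodRatio; fun_prop

/-- The unboosted mean `1 / 2`. -/
def halfMean : unitInterval := ⟨1 / 2, by norm_num, by norm_num⟩

/-- The two instances differ only in the value law of platform `j`, and that value is seen only when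
the platform is won. So one factor, present only on a win, converts one law into the other. -/
theorem lintegral_feedbackKernel_change_measure (hB : (m : ℝ) ≤ B)
    (hbid : ∀ b ∈ bidSet, b ∈ Set.Icc (0 : ℝ) 1) (j : Fin m) (b : BidVector m bidSet)
    {f : Feedback m → ℝ≥0∞} (hf : Measurable f) :
    ∫⁻ y, f y ∂((boostedInstance T hB hbid j).feedbackKernel b) =
      ∫⁻ y, (if winBid j b = 1 then likelihoodRatio (boost m B) (y j).2.2 else 1) * f y
        ∂((bernoulliInstance T ((Nat.cast_nonneg m).trans hB) hbid
          (fun _ => halfMean)).feedbackKernel b) := by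
  have hB0 : 0 ≤ B := (Nat.cast_nonneg m).trans hB
  have hε := boost_mem hB
  have hlik : Measurable fun y : Feedback m =>
      (if winBid j b = 1 then likelihoodRatio (boost m B) (y j).2.2 else 1) := by
    split_ifs
    · exact (measurable_likelihoodRatio _).comp (by fun_prop)
    · fun_prop
  have hlf : Measurable fun y : Feedback m =>
      (if winBid j b = 1 then likelihoodRatio (boost m B) (y j).2.2 else 1) * f y := hlik.mul hf
  rw [lintegral_feedbackKernel _ _ hf, lintegral_feedbackKernel _ _ hlf]
  -- The form `n + 1` allows coordinate `j` to be split off and integrated separately from the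
  -- others.
  obtain ⟨n, rfl⟩ : ∃ n, m = n + 1 := ⟨m - 1, by have := j.2; omega⟩
  have key (μ : Fin (n + 1) → unitInterval) {g : (Fin (n + 1) → ℝ × ℝ) → ℝ≥0∞}
      (hg : Measurable g) :
      ∫⁻ x, g x ∂(bernoulliInstance T hB0 hbid μ).outcomeLaw =
        ∫⁻ z, (ENNReal.ofReal (μ j) * g (j.insertNth (1 / 2, 1) z) +
          ENNReal.ofReal (1 - μ j) * g (j.insertNth (1 / 2, 0) z))
          ∂(Measure.pi fun i => (Measure.dirac (1 / 2 : ℝ)).prod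
            (bernoulliMeasure (1 : ℝ) 0 (μ (j.succAbove i)))) := by
    have hp := measurePreserving_piFinSuccAbove
      (fun i => (Measure.dirac (1 / 2 : ℝ)).prod (bernoulliMeasure (1 : ℝ) 0 (μ i))) j
    have h1 := hp.symm.lintegral_comp hg
    change ∫⁻ x, g x ∂(Measure.pi _) = _
    change _ = ∫⁻ x, g x ∂(Measure.pi _) at h1
    have hgm : Measurable fun p : (ℝ × ℝ) × (Fin n → ℝ × ℝ) =>
        g (j.insertNth (α := fun _ => ℝ × ℝ) p.1 p.2) :=
      hg.comp (MeasurableEquiv.piFinSuccAbove (fun _ => ℝ × ℝ) j).symm.measurable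
    refine h1.symm.trans ?_
    refine (lintegral_prod_symm _ hgm.aemeasurable).trans ?_
    refine lintegral_congr fun z => ?_
    exact lintegral_dirac_prod_bernoulliMeasure _ (hgm.comp (by fun_prop))
  rw [boostedInstance_eq,
    key _ (show Measurable fun x => f (feedback b x) from hf.comp (measurable_feedback b)),
    key _ (show Measurable fun x => (if winBid j b = 1 then likelihoodRatio (boost (n + 1 : ℕ) B)
      (feedback b x j).2.2 else 1) * f (feedback b x) from hlf.comp (measurable_feedback b))]
  have hrest : (fun i => (Measure.dirac (1 / 2 : ℝ)).prod
        (bernoulliMeasure (1 : ℝ) 0 (boostedMean hB j (j.succAbove i)))) =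
      fun i => (Measure.dirac (1 / 2 : ℝ)).prod (bernoulliMeasure (1 : ℝ) 0 halfMean) := by
    funext i
    congr 2
    exact Subtype.ext (if_neg (Fin.succAbove_ne j i))
  rw [hrest]
  refine lintegral_congr fun z => ?_
  have hmean : ((boostedMean hB j j : unitInterval) : ℝ) = 1 / 2 * (1 + boost _ B) := if_pos rfl
  rw [hmean]
  simp only [halfMean]
  set ε := boost (n + 1 : ℕ) B
  by_cases hw : (1 / 2 : ℝ) ≤ b j
  · have hw' : winBid j b = 1 := if_pos hw
    have hv (v : ℝ) : (feedback b (j.insertNth (1 / 2, v) z) j).2.2 = v := by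
      simp only [feedback, Fin.insertNth_apply_same, hw, if_true]
    simp only [hw', if_true, hv, likelihoodRatio, ← mul_assoc]
    rw [← ENNReal.ofReal_mul (by norm_num), ← ENNReal.ofReal_mul (by norm_num)]
    congr 3 <;> congr 1 <;> ring
  -- A lost auction hides the value, so both outcomes give the same feedback and only their total
  -- mass `1` matters.
  · have hw' : winBid j b ≠ 1 := by rw [winBid, if_neg hw]; exact zero_ne_one
    have hv : feedback b (j.insertNth (1 / 2, 1) z) = feedback b (j.insertNth (1 / 2, 0) z) := by
      funext i
      rcases eq_or_ne i j with rfl | hij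
      · simp only [feedback, Fin.insertNth_apply_same]; rw [if_neg hw, if_neg hw]
      · obtain ⟨k, rfl⟩ := Fin.exists_succAbove_eq hij
        simp only [feedback, Fin.insertNth_apply_succAbove]
    simp only [hw', if_false, one_mul, hv, ← add_mul]
    rw [← ENNReal.ofReal_add (by nlinarith [hε.1]) (by nlinarith [hε.2]),
      ← ENNReal.ofReal_add (by norm_num) (by norm_num)]
    congr 2
    ring

/-- The ratio is `1 + ε` or `1 - ε` with equal probability. The case `k = 1` gives mean `1`, and `k
= 2` gives second moment `1 + ε²`. -/
theorem lintegral_likelihoodRatio_pow (hB : (m : ℝ) ≤ B)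
    (hbid : ∀ b ∈ bidSet, b ∈ Set.Icc (0 : ℝ) 1) {j : Fin m} {b : BidVector m bidSet}
    (hw : winBid j b = 1) (k : ℕ) :
    ∫⁻ y, likelihoodRatio (boost m B) (y j).2.2 ^ k
        ∂((bernoulliInstance T ((Nat.cast_nonneg m).trans hB) hbid
          (fun _ => halfMean)).feedbackKernel b) =
      ENNReal.ofReal (((1 + boost m B) ^ k + (1 - boost m B) ^ k) / 2) := by
  have hε := boost_mem hB
  have hw' : (1 / 2 : ℝ) ≤ b j := by
    by_contra h
    exact absurd hw (by rw [winBid, if_neg h]; exact zero_ne_one)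
  have hlik : Measurable fun y : Feedback m => likelihoodRatio (boost m B) (y j).2.2 ^ k :=
    ((measurable_likelihoodRatio _).comp (by fun_prop)).pow_const k
  rw [lintegral_feedbackKernel _ _ hlik]
  let f : ℝ × ℝ → ℝ≥0∞ := fun a =>
    likelihoodRatio (boost m B) (if a.1 ≤ b j then (true, a.1, a.2) else (false, 0, 0)).2.2 ^ k
  have hf : Measurable f := by
    refine ((measurable_likelihoodRatio _).comp ?_).pow_const k
    have hite : Measurable fun a : ℝ × ℝ =>
        if a.1 ≤ b j then (true, a.1, a.2) else (false, 0, 0) :=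
      Measurable.ite (measurableSet_le (by fun_prop) (by fun_prop)) (by fun_prop) (by fun_prop)
    exact measurable_snd.comp (measurable_snd.comp hite)
  refine (lintegral_outcomeLaw_eval _ _ _ j hf).trans ?_
  simp only [f, hw', if_true, likelihoodRatio, halfMean]
  rw [← ENNReal.ofReal_pow (by nlinarith [hε.1]), ← ENNReal.ofReal_pow (by nlinarith [hε.2]),
    ← ENNReal.ofReal_mul (by norm_num), ← ENNReal.ofReal_mul (by norm_num),
    ← ENNReal.ofReal_add]
  · congr 1; ring
  · exact mul_nonneg (by norm_num) (pow_nonneg (by linarith [hε.1]) _)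
  · exact mul_nonneg (by norm_num) (pow_nonneg (by linarith [hε.2]) _)

theorem lintegral_roundReward (hB : 0 ≤ B) (hbid : ∀ b ∈ bidSet, b ∈ Set.Icc (0 : ℝ) 1)
    (μ : Fin m → unitInterval) (b : BidVector m bidSet) :
    ∫⁻ y, ENNReal.ofReal (roundReward y) ∂((bernoulliInstance T hB hbid μ).feedbackKernel b) =
      ∑ i, ENNReal.ofReal (μ i) * winBid i b := by
  let f : Fin m → ℝ × ℝ → ℝ≥0∞ := fun i a =>
    ENNReal.ofReal (if a.1 ≤ b i then a.2 else 0)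
  have hf (i : Fin m) : Measurable (f i) := by
    refine ENNReal.measurable_ofReal.comp (Measurable.ite ?_ (by fun_prop) (by fun_prop))
    exact measurableSet_le (by fun_prop) (by fun_prop)
  have h1 : ∫⁻ y, ENNReal.ofReal (roundReward y)
        ∂((bernoulliInstance T hB hbid μ).feedbackKernel b) =
      ∫⁻ y, ∑ i, ENNReal.ofReal (if (y i).1 then (y i).2.2 else 0)
        ∂((bernoulliInstance T hB hbid μ).feedbackKernel b) := by
    refine lintegral_congr_ae ?_
    filter_upwards [ae_validRecord hB hbid μ b] with y hy
    refine ENNReal.ofReal_sum_of_nonneg fun i _ => ?_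
    rcases hy i with ⟨_, h, _, hv⟩ | ⟨_, h⟩ <;> dsimp only at h
    · simpa [h] using hv.1
    · simp [h]
  have hg (i : Fin m) : Measurable fun y : Feedback m =>
      ENNReal.ofReal (if (y i).1 then (y i).2.2 else 0) := by
    refine ENNReal.measurable_ofReal.comp (Measurable.ite ?_ (by fun_prop) (by fun_prop))
    exact (measurable_fst.comp (measurable_pi_apply i)) (measurableSet_singleton true)
  rw [h1, lintegral_finsetSum _ fun i _ => hg i]
  refine Finset.sum_congr rfl fun i _ => ?_
  rw [lintegral_feedbackKernel _ _ (hg i)]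
  have h2 (x : Fin m → ℝ × ℝ) :
      ENNReal.ofReal (if (feedback b x i).1 then (feedback b x i).2.2 else 0) = f i (x i) := by
    by_cases h : (x i).1 ≤ b i <;> simp [feedback, f, h]
  simp only [h2]
  rw [lintegral_outcomeLaw_eval _ _ _ i (hf i)]
  by_cases h : (1 / 2 : ℝ) ≤ b i
  · simp only [f, winBid, h, if_true]; simp
  · simp only [f, winBid, h, if_false]; simp

/-! ### Statistics of a history -/

/-- The number of auctions won in the first `t` rounds, on all platforms. -/
def totalWins : (t : ℕ) → (Fin t → RoundRecord m bidSet) → ℕ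
  | 0, _ => 0
  | t + 1, h => totalWins t (Fin.init h) + winCount (h (Fin.last t)).1

/-- The number of auctions won in the first `t` rounds on platform `j`. -/
def platformWins (j : Fin m) : (t : ℕ) → (Fin t → RoundRecord m bidSet) → ℕ
  | 0, _ => 0
  | t + 1, h => platformWins j t (Fin.init h) + winBid j (h (Fin.last t)).1

/-- The number of wins on platform `j` in the rounds after which at most `S` auctions are won in
total. -/
def cappedWins (S : ℕ) (j : Fin m) : (t : ℕ) → (Fin t → RoundRecord m bidSet) → ℕ
  | 0, _ => 0
  | t + 1, h => cappedWins S j t (Fin.init h) +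
      if totalWins (t + 1) h ≤ S then winBid j (h (Fin.last t)).1 else 0

/-- The indicator that platform `j` is won more than `K` times before more than `S` auctions are
won in total. -/
def exceedsQuota (S K : ℕ) (j : Fin m) : (t : ℕ) → (Fin t → RoundRecord m bidSet) → ℕ
  | 0, _ => 0
  | t + 1, h => exceedsQuota S K j t (Fin.init h) +
      if totalWins (t + 1) h ≤ S ∧ platformWins j t (Fin.init h) = K
        then winBid j (h (Fin.last t)).1 else 0

/-- The reward of the rounds after which at most `S` auctions are won in total. -/
def cappedReward (S : ℕ) : (t : ℕ) → (Fin t → RoundRecord m bidSet) → ℝ≥0∞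
  | 0, _ => 0
  | t + 1, h => cappedReward S t (Fin.init h) +
      if totalWins (t + 1) h ≤ S then ENNReal.ofReal (roundReward (h (Fin.last t)).2) else 0

/-- The likelihood ratio of the first `K` values observed on platform `j`. -/
def historyLikelihood (ε : ℝ) (K : ℕ) (j : Fin m) :
    (t : ℕ) → (Fin t → RoundRecord m bidSet) → ℝ≥0∞
  | 0, _ => 1
  | t + 1, h => historyLikelihood ε K j t (Fin.init h) *
      if winBid j (h (Fin.last t)).1 = 1 ∧ platformWins j (t + 1) h ≤ K
        then likelihoodRatio ε ((h (Fin.last t)).2 j).2.2 else 1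

/-- The total number of wins never decreases, so once it passes `S` the capped counts stay frozen.
-/
theorem sum_cappedWins_invariant (S t : ℕ) (h : Fin t → RoundRecord m bidSet) :
    (totalWins t h ≤ S ∧ ∑ j, cappedWins S j t h = totalWins t h) ∨
      (S < totalWins t h ∧ ∑ j, cappedWins S j t h ≤ S) := by
  induction t with
  | zero => simp [totalWins, cappedWins]
  | succ t ih =>
    have := ih (Fin.init h)
    simp only [cappedWins, Finset.sum_add_distrib]
    by_cases hS : totalWins (t + 1) h ≤ S
    · simp only [hS, if_true]
      have hsum : ∑ j, winBid j (h (Fin.last t)).1 = winCount (h (Fin.last t)).1 := rfl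
      rw [hsum]
      simp only [totalWins, true_and] at hS ⊢
      omega
    · simp only [hS, if_false, Finset.sum_const_zero]
      simp only [totalWins] at hS ⊢
      omega

theorem sum_cappedWins_le (S t : ℕ) (h : Fin t → RoundRecord m bidSet) :
    ∑ j, cappedWins S j t h ≤ S := by
  have := sum_cappedWins_invariant S t h
  omega

/-- A platform gains at most one win per round, so its count passes from `K` to `K + 1` at most
once. This makes the sum defining `exceedsQuota` an indicator. -/
theorem exceedsQuota_invariant (S K : ℕ) (j : Fin m) (t : ℕ) (h : Fin t → RoundRecord m bidSet) :
    (totalWins t h ≤ S ∧ cappedWins S j t h = platformWins j t h ∧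
      ((platformWins j t h ≤ K ∧ exceedsQuota S K j t h = 0) ∨
        (K + 1 ≤ platformWins j t h ∧ exceedsQuota S K j t h = 1))) ∨
    (S < totalWins t h ∧ (exceedsQuota S K j t h = 0 ∨
      (exceedsQuota S K j t h = 1 ∧ K + 1 ≤ cappedWins S j t h))) := by
  induction t with
  | zero => simp [totalWins, cappedWins, platformWins, exceedsQuota]
  | succ t ih =>
    have := ih (Fin.init h)
    have h1 := winBid_le_one j (h (Fin.last t)).1
    simp only [totalWins, cappedWins, platformWins, exceedsQuota]
    by_cases hS : totalWins t (Fin.init h) + winCount (h (Fin.last t)).1 ≤ S <;>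
      by_cases hK : platformWins j t (Fin.init h) = K <;>
      simp only [hS, hK, true_and, false_and, if_true, if_false] at this ⊢ <;> omega

theorem exceedsQuota_le (S K : ℕ) (j : Fin m) (t : ℕ) (h : Fin t → RoundRecord m bidSet) :
    (K + 1) * exceedsQuota S K j t h ≤ cappedWins S j t h := by
  rcases exceedsQuota_invariant S K j t h with ⟨_, h2, ⟨_, h3⟩ | ⟨_, h3⟩⟩ | ⟨_, h2 | ⟨h2, h3⟩⟩ <;>
    simp_all

theorem exceedsQuota_le_one (S K : ℕ) (j : Fin m) (t : ℕ) (h : Fin t → RoundRecord m bidSet) :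
    exceedsQuota S K j t h ≤ 1 := by
  have := exceedsQuota_invariant S K j t h
  omega

/-- When the total first passes `S`, platform `j` has at most `K + 1` of at least `S + 1` wins, so
at least `L` wins lie elsewhere. The deficit cannot shrink later, because a win on `j` also counts
in the total; it survives until the cap `U` freezes the count. A single round may jump from below
`S` to above `U`, and then `L + S ≤ U` suffices. -/
theorem cappedWins_invariant {S K L U : ℕ} (hK : L + K ≤ S) (hU : L + S ≤ U) (j : Fin m) (t : ℕ)
    (h : Fin t → RoundRecord m bidSet) (hQ : exceedsQuota S K j t h = 0) :
    (totalWins t h ≤ S ∧ cappedWins U j t h = platformWins j t h ∧ platformWins j t h ≤ K) ∨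
    (S < totalWins t h ∧ totalWins t h ≤ U ∧ cappedWins U j t h = platformWins j t h ∧
      platformWins j t h + L ≤ totalWins t h) ∨
    (U < totalWins t h ∧ cappedWins U j t h + L ≤ U) := by
  induction t with
  | zero => simp [totalWins, cappedWins, platformWins]
  | succ t ih =>
    have h1 := winBid_le_one j (h (Fin.last t)).1
    have h2 := winBid_le_winCount j (h (Fin.last t)).1
    simp only [totalWins, cappedWins, platformWins, exceedsQuota] at hQ ⊢
    have := ih (Fin.init h) (by omega)
    by_cases hS : totalWins t (Fin.init h) + winCount (h (Fin.last t)).1 ≤ S <;>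
      by_cases hK : platformWins j t (Fin.init h) = K <;>
      by_cases hU : totalWins t (Fin.init h) + winCount (h (Fin.last t)).1 ≤ U <;>
      simp only [hS, hK, hU, true_and, false_and, if_true, if_false] at hQ this ⊢ <;> omega

theorem cappedWins_add_le {S K L U : ℕ} (hK : L + K ≤ S) (hU : L + S ≤ U) (j : Fin m) (t : ℕ)
    (h : Fin t → RoundRecord m bidSet) :
    cappedWins U j t h + L ≤ U + L * exceedsQuota S K j t h := by
  have h1 := exceedsQuota_le_one S K j t h
  have h2 : cappedWins U j t h ≤ U :=
    (Finset.single_le_sum (f := fun j => cappedWins U j t h) (fun _ _ => Nat.zero_le _)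
      (Finset.mem_univ j)).trans (sum_cappedWins_le U t h)
  obtain hQ | hQ : exceedsQuota S K j t h = 0 ∨ exceedsQuota S K j t h = 1 := by omega
  · have := cappedWins_invariant hK hU j t h hQ
    rw [hQ]
    omega
  · rw [hQ]; omega

/-! ### Measurability -/

theorem measurable_finInit {α : Type*} [MeasurableSpace α] (t : ℕ) :
    Measurable fun h : Fin (t + 1) → α => Fin.init (α := fun _ => α) h :=
  measurable_pi_iff.2 fun i => measurable_pi_apply i.castSucc

theorem measurable_finSnoc {α : Type*} [MeasurableSpace α] (t : ℕ) :
    Measurable fun x : (Fin t → α) × α => Fin.snoc (α := fun _ => α) x.1 x.2 := by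
  refine measurable_pi_iff.2 fun i => ?_
  refine Fin.lastCases ?_ (fun i => ?_) i
  · simpa using measurable_snd
  · simpa using! (measurable_pi_apply i).comp measurable_fst

theorem measurable_lastBid {α : Type*} [MeasurableSpace α] (t : ℕ) (g : BidVector m bidSet → α) :
    Measurable fun h : Fin (t + 1) → RoundRecord m bidSet => g (h (Fin.last t)).1 :=
  (Measurable.of_discrete (f := g)).comp (measurable_fst.comp (measurable_pi_apply _))

theorem measurable_totalWins (t : ℕ) :
    Measurable (totalWins (m := m) (bidSet := bidSet) t) := by
  induction t with
  | zero => exact measurable_const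
  | succ t ih => exact (ih.comp (measurable_finInit t)).add (measurable_lastBid t winCount)

theorem measurable_platformWins (j : Fin m) (t : ℕ) :
    Measurable (platformWins (bidSet := bidSet) j t) := by
  induction t with
  | zero => exact measurable_const
  | succ t ih => exact (ih.comp (measurable_finInit t)).add (measurable_lastBid t (winBid j))

theorem measurableSet_totalWins_le (S t : ℕ) :
    MeasurableSet {h : Fin t → RoundRecord m bidSet | totalWins t h ≤ S} :=
  measurable_totalWins t (MeasurableSet.of_discrete (s := Set.Iic S))

theorem measurableSet_platformWins_le (K : ℕ) (j : Fin m) (t : ℕ) :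
    MeasurableSet {h : Fin t → RoundRecord m bidSet | platformWins j t h ≤ K} :=
  measurable_platformWins j t (MeasurableSet.of_discrete (s := Set.Iic K))

theorem measurable_cappedWins (S : ℕ) (j : Fin m) (t : ℕ) :
    Measurable (cappedWins (bidSet := bidSet) S j t) := by
  induction t with
  | zero => exact measurable_const
  | succ t ih =>
    exact (ih.comp (measurable_finInit t)).add (Measurable.ite (measurableSet_totalWins_le S _)
      (measurable_lastBid t (winBid j)) measurable_const)

theorem measurable_exceedsQuota (S K : ℕ) (j : Fin m) (t : ℕ) :
    Measurable (exceedsQuota (bidSet := bidSet) S K j t) := by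
  induction t with
  | zero => exact measurable_const
  | succ t ih =>
    refine (ih.comp (measurable_finInit t)).add (Measurable.ite
      ((measurableSet_totalWins_le S _).inter ?_) (measurable_lastBid t (winBid j))
      measurable_const)
    exact ((measurable_platformWins j t).comp (measurable_finInit t)) (measurableSet_singleton K)

theorem measurable_cappedReward (S t : ℕ) :
    Measurable (cappedReward (m := m) (bidSet := bidSet) S t) := by
  induction t with
  | zero => exact measurable_const
  | succ t ih =>
    exact (ih.comp (measurable_finInit t)).add (Measurable.ite (measurableSet_totalWins_le S _)
      (ENNReal.measurable_ofReal.comp (measurable_roundReward.comp (by fun_prop)))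
      measurable_const)

theorem measurable_historyLikelihood (ε : ℝ) (K : ℕ) (j : Fin m) (t : ℕ) :
    Measurable (historyLikelihood (bidSet := bidSet) ε K j t) := by
  induction t with
  | zero => exact measurable_const
  | succ t ih =>
    refine (ih.comp (measurable_finInit t)).mul (Measurable.ite
      (MeasurableSet.inter ?_ (measurableSet_platformWins_le K j _))
      ((measurable_likelihoodRatio ε).comp (by fun_prop)) measurable_const)
    exact (measurable_lastBid t (winBid j)) (measurableSet_singleton 1)

/-! ### The law of a history -/

namespace BiddingInstance

/-- The law of the record of round `t`, given the record of the rounds before. -/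
def roundKernel (I : BiddingInstance m T bidSet) (A : BiddingAlgorithm m bidSet) (t : ℕ) :
    Kernel (Fin t → RoundRecord m bidSet) (RoundRecord m bidSet) :=
  (A.policy t).compProd (Kernel.prodMkLeft _ I.feedbackKernel)

instance (I : BiddingInstance m T bidSet) (A : BiddingAlgorithm m bidSet) (t : ℕ) :
    IsMarkovKernel (I.roundKernel A t) := by
  unfold roundKernel; infer_instance

theorem historyLaw_succ (I : BiddingInstance m T bidSet) (A : BiddingAlgorithm m bidSet) (t : ℕ) :
    I.historyLaw A (t + 1) = ((I.historyLaw A t).compProd (I.roundKernel A t)).map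
      fun x => Fin.snoc (α := fun _ => RoundRecord m bidSet) x.1 x.2 := rfl

instance isProbabilityMeasure_historyLaw (I : BiddingInstance m T bidSet)
    (A : BiddingAlgorithm m bidSet) (t : ℕ) : IsProbabilityMeasure (I.historyLaw A t) := by
  induction t with
  | zero => exact Measure.dirac.isProbabilityMeasure
  | succ t ih =>
    rw [historyLaw_succ]
    exact Measure.isProbabilityMeasure_map (measurable_finSnoc t).aemeasurable

theorem lintegral_roundKernel (I : BiddingInstance m T bidSet) (A : BiddingAlgorithm m bidSet)
    (t : ℕ) (h : Fin t → RoundRecord m bidSet) {f : RoundRecord m bidSet → ℝ≥0∞}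
    (hf : Measurable f) :
    ∫⁻ r, f r ∂(I.roundKernel A t h) =
      ∫⁻ b, ∫⁻ y, f (b, y) ∂(I.feedbackKernel b) ∂(A.policy t h) := by
  rw [roundKernel, Kernel.lintegral_compProd _ _ _ hf]
  rfl

theorem lintegral_historyLaw_succ (I : BiddingInstance m T bidSet) (A : BiddingAlgorithm m bidSet)
    (t : ℕ) {f : (Fin (t + 1) → RoundRecord m bidSet) → ℝ≥0∞} (hf : Measurable f) :
    ∫⁻ h, f h ∂(I.historyLaw A (t + 1)) =
      ∫⁻ h, ∫⁻ r, f (Fin.snoc (α := fun _ => RoundRecord m bidSet) h r)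
        ∂(I.roundKernel A t h) ∂(I.historyLaw A t) := by
  rw [historyLaw_succ, lintegral_map hf (measurable_finSnoc t),
    Measure.lintegral_compProd (show Measurable fun x => f (Fin.snoc x.1 x.2) from
      hf.comp (measurable_finSnoc t))]

theorem lintegral_historyLaw_zero (I : BiddingInstance m T bidSet) (A : BiddingAlgorithm m bidSet)
    {f : (Fin 0 → RoundRecord m bidSet) → ℝ≥0∞} (hf : Measurable f) :
    ∫⁻ h, f h ∂(I.historyLaw A 0) = f Fin.elim0 :=
  lintegral_dirac' _ hf

/-- The expectation of a quantity that accumulates over the rounds. -/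
theorem lintegral_historyLaw_succ_add (I : BiddingInstance m T bidSet)
    (A : BiddingAlgorithm m bidSet) (t : ℕ) {F : (Fin t → RoundRecord m bidSet) → ℝ≥0∞}
    (hF : Measurable F) {g : (Fin t → RoundRecord m bidSet) → RoundRecord m bidSet → ℝ≥0∞}
    (hg : Measurable (Function.uncurry g)) :
    ∫⁻ h, F (Fin.init h) + g (Fin.init h) (h (Fin.last t)) ∂(I.historyLaw A (t + 1)) =
      ∫⁻ h, F h ∂(I.historyLaw A t) +
        ∫⁻ h, ∫⁻ r, g h r ∂(I.roundKernel A t h) ∂(I.historyLaw A t) := by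
  have h1 : Measurable fun h : Fin (t + 1) → RoundRecord m bidSet =>
      g (Fin.init h) (h (Fin.last t)) :=
    hg.comp ((measurable_finInit t).prodMk (measurable_pi_apply _))
  have h2 : Measurable fun h : Fin (t + 1) → RoundRecord m bidSet => F (Fin.init h) :=
    hF.comp (measurable_finInit t)
  rw [lintegral_historyLaw_succ _ _ _ (show Measurable fun h => F (Fin.init h) +
      g (Fin.init h) (h (Fin.last t)) from h2.add h1), ← lintegral_add_left hF]
  refine lintegral_congr fun h => ?_
  simp only [Fin.init_snoc, Fin.snoc_last]
  rw [lintegral_add_left measurable_const, lintegral_const, measure_univ, mul_one]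

end BiddingInstance

theorem measurable_recordBid {α : Type*} [MeasurableSpace α] (t : ℕ)
    (g : BidVector m bidSet → α) :
    Measurable fun p : (Fin t → RoundRecord m bidSet) × RoundRecord m bidSet => g p.2.1 :=
  (Measurable.of_discrete (f := g)).comp (measurable_fst.comp measurable_snd)

theorem measurableSet_totalWins_add_le (S t : ℕ) :
    MeasurableSet {p : (Fin t → RoundRecord m bidSet) × RoundRecord m bidSet |
      totalWins t p.1 + winCount p.2.1 ≤ S} :=
  (((measurable_totalWins t).comp measurable_fst).add (measurable_recordBid t winCount))
    (MeasurableSet.of_discrete (s := Set.Iic S))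

theorem measurable_natCast_ennreal : Measurable fun n : ℕ => (n : ℝ≥0∞) := Measurable.of_discrete

/-! ### Expected reward in terms of win counts. -/

namespace BiddingInstance

/-- Prices are deterministic, so whether a round is counted depends only on the bids up to and
including that round. Its values are drawn independently of this and may be replaced by their means.
-/
theorem lintegral_cappedReward (hB : 0 ≤ B) (hbid : ∀ b ∈ bidSet, b ∈ Set.Icc (0 : ℝ) 1)
    (μ : Fin m → unitInterval) (A : BiddingAlgorithm m bidSet) (S t : ℕ) :
    ∫⁻ h, cappedReward S t h ∂((bernoulliInstance T hB hbid μ).historyLaw A t) =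
      ∫⁻ h, ∑ i, ENNReal.ofReal (μ i) * (cappedWins S i t h : ℝ≥0∞)
        ∂((bernoulliInstance T hB hbid μ).historyLaw A t) := by
  set I := bernoulliInstance T hB hbid μ with hI
  induction t with
  | zero => simp [cappedReward, cappedWins]
  | succ t ih =>
    let g₁ : (Fin t → RoundRecord m bidSet) → RoundRecord m bidSet → ℝ≥0∞ := fun h r =>
      if totalWins t h + winCount r.1 ≤ S then ENNReal.ofReal (roundReward r.2) else 0
    let g₂ : (Fin t → RoundRecord m bidSet) → RoundRecord m bidSet → ℝ≥0∞ := fun h r =>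
      if totalWins t h + winCount r.1 ≤ S then ∑ i, ENNReal.ofReal (μ i) * (winBid i r.1 : ℝ≥0∞)
        else 0
    have hg₁ : Measurable (Function.uncurry g₁) :=
      Measurable.ite (measurableSet_totalWins_add_le S t)
        (ENNReal.measurable_ofReal.comp (measurable_roundReward.comp (by fun_prop)))
        measurable_const
    have hg₂ : Measurable (Function.uncurry g₂) :=
      Measurable.ite (measurableSet_totalWins_add_le S t)
        (measurable_recordBid t fun b => ∑ i, ENNReal.ofReal (μ i) * (winBid i b : ℝ≥0∞))
        measurable_const
    have hF₂ : Measurable fun h : Fin t → RoundRecord m bidSet =>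
        ∑ i, ENNReal.ofReal (μ i) * (cappedWins S i t h : ℝ≥0∞) :=
      Finset.measurable_sum _ fun i _ =>
        (measurable_natCast_ennreal.comp (measurable_cappedWins S i t)).const_mul _
    have h₁ := lintegral_historyLaw_succ_add I A t (measurable_cappedReward S t) hg₁
    have h₂ := lintegral_historyLaw_succ_add I A t hF₂ hg₂
    have hinner (h : Fin t → RoundRecord m bidSet) :
        ∫⁻ r, g₁ h r ∂(I.roundKernel A t h) = ∫⁻ r, g₂ h r ∂(I.roundKernel A t h) := by
      rw [lintegral_roundKernel _ _ _ _ (show Measurable (g₁ h) from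
          hg₁.comp measurable_prodMk_left),
        lintegral_roundKernel _ _ _ _ (show Measurable (g₂ h) from
          hg₂.comp measurable_prodMk_left)]
      refine lintegral_congr fun b => ?_
      by_cases hS : totalWins t h + winCount b ≤ S
      · simp only [g₁, g₂, hS, if_true]
        rw [lintegral_roundReward, lintegral_const, measure_univ, mul_one]
      · simp only [g₁, g₂, hS, if_false]
    simp only [hinner, ih] at h₁
    refine h₁.trans (h₂.symm.trans (lintegral_congr fun h => ?_))
    by_cases hS : totalWins t (Fin.init h) + winCount (h (Fin.last t)).1 ≤ S
    · simp only [cappedWins, totalWins, g₂, hS, if_true, Nat.cast_add, mul_add,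
        Finset.sum_add_distrib]
    · simp only [cappedWins, totalWins, g₂, hS, if_false, add_zero]

/-! ### Likelihood ratio of a history, truncated after `K` wins on platform `j`. -/

variable (hB : (m : ℝ) ≤ B) (hbid : ∀ b ∈ bidSet, b ∈ Set.Icc (0 : ℝ) 1)

/-- The instance in which no platform is boosted. -/
abbrev baseInstance (T : ℕ) (hB : (m : ℝ) ≤ B) (hbid : ∀ b ∈ bidSet, b ∈ Set.Icc (0 : ℝ) 1) :
    BiddingInstance m T bidSet :=
  bernoulliInstance T ((Nat.cast_nonneg m).trans hB) hbid fun _ => halfMean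

theorem historyLikelihood_snoc (ε : ℝ) (K : ℕ) (j : Fin m) (t : ℕ)
    (h : Fin t → RoundRecord m bidSet) (b : BidVector m bidSet) (y : Feedback m) :
    historyLikelihood ε K j (t + 1)
        (Fin.snoc (α := fun _ => RoundRecord m bidSet) h (b, y)) =
      historyLikelihood ε K j t h *
        if winBid j b = 1 ∧ platformWins j t h + winBid j b ≤ K
          then likelihoodRatio ε (y j).2.2 else 1 := by
  simp only [historyLikelihood, platformWins, Fin.init_snoc, Fin.snoc_last]

theorem platformWins_snoc (j : Fin m) (t : ℕ)
    (h : Fin t → RoundRecord m bidSet) (b : BidVector m bidSet) (y : Feedback m) :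
    platformWins j (t + 1) (Fin.snoc (α := fun _ => RoundRecord m bidSet) h (b, y)) =
      platformWins j t h + winBid j b := by
  simp only [platformWins, Fin.init_snoc, Fin.snoc_last]

theorem measurable_roundFactor (ε : ℝ) (p : BidVector m bidSet → Prop) [DecidablePred p]
    (j : Fin m) :
    Measurable fun r : RoundRecord m bidSet =>
      if p r.1 then likelihoodRatio ε (r.2 j).2.2 else 1 :=
  Measurable.ite (measurable_fst (MeasurableSet.of_discrete (s := {b | p b})))
    ((measurable_likelihoodRatio ε).comp (by fun_prop)) measurable_const

/-- Change of measure on histories that satisfy the quota. -/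
theorem lintegral_historyLaw_change_measure (A : BiddingAlgorithm m bidSet) (K : ℕ) (j : Fin m)
    (t : ℕ) {f : (Fin t → RoundRecord m bidSet) → ℝ≥0∞} (hf : Measurable f)
    (hK : ∀ h, K < platformWins j t h → f h = 0) :
    ∫⁻ h, f h ∂((boostedInstance T hB hbid j).historyLaw A t) =
      ∫⁻ h, historyLikelihood (boost m B) K j t h * f h
        ∂((baseInstance T hB hbid).historyLaw A t) := by
  set ε := boost m B
  induction t with
  | zero =>
    rw [lintegral_historyLaw_zero _ _ hf,
      lintegral_historyLaw_zero _ _ (show Measurable fun h => historyLikelihood ε K j 0 h * f h from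
        (measurable_historyLikelihood ε K j 0).mul hf)]
    simp [historyLikelihood]
  | succ t ih =>
    have hs (h : Fin t → RoundRecord m bidSet) : Measurable fun r : RoundRecord m bidSet =>
        f (Fin.snoc (α := fun _ => RoundRecord m bidSet) h r) :=
      (hf.comp (measurable_finSnoc t)).comp measurable_prodMk_left
    let φ : RoundRecord m bidSet → ℝ≥0∞ := fun r =>
      if winBid j r.1 = 1 then likelihoodRatio ε (r.2 j).2.2 else 1
    have hφ : Measurable φ := measurable_roundFactor ε (fun b => winBid j b = 1) j
    let G : (Fin t → RoundRecord m bidSet) → ℝ≥0∞ := fun h =>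
      ∫⁻ r, φ r * f (Fin.snoc (α := fun _ => RoundRecord m bidSet) h r)
        ∂((baseInstance T hB hbid).roundKernel A t h)
    have hφf : Measurable fun p : (Fin t → RoundRecord m bidSet) × RoundRecord m bidSet =>
        φ p.2 * f (Fin.snoc (α := fun _ => RoundRecord m bidSet) p.1 p.2) :=
      (hφ.comp measurable_snd).mul (hf.comp (measurable_finSnoc t))
    have hφs (h : Fin t → RoundRecord m bidSet) : Measurable fun r : RoundRecord m bidSet =>
        φ r * f (Fin.snoc (α := fun _ => RoundRecord m bidSet) h r) := hφ.mul (hs h)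
    have hG : Measurable G := Measurable.lintegral_kernel_prod_right' hφf
    -- Win counts never decrease, so the integrated function inherits the support condition needed
    -- for the induction hypothesis.
    have hGK (h : Fin t → RoundRecord m bidSet) (hh : K < platformWins j t h) : G h = 0 := by
      have (r : RoundRecord m bidSet) :
          f (Fin.snoc (α := fun _ => RoundRecord m bidSet) h r) = 0 := by
        refine hK _ ?_
        rw [← Prod.mk.eta (p := r), platformWins_snoc]
        omega
      simp [G, this]
    have hleft (h : Fin t → RoundRecord m bidSet) :
        ∫⁻ r, f (Fin.snoc (α := fun _ => RoundRecord m bidSet) h r)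
          ∂((boostedInstance T hB hbid j).roundKernel A t h) = G h := by
      rw [lintegral_roundKernel _ _ _ _ (hs h)]
      simp only [G]
      rw [lintegral_roundKernel _ _ _ _ (hφs h)]
      refine lintegral_congr fun b => ?_
      exact lintegral_feedbackKernel_change_measure hB hbid j b
        ((hs h).comp measurable_prodMk_left)
    rw [lintegral_historyLaw_succ _ _ _ hf, lintegral_historyLaw_succ _ _ _
      (show Measurable fun h => historyLikelihood ε K j (t + 1) h * f h from
        (measurable_historyLikelihood ε K j (t + 1)).mul hf)]
    simp only [hleft]
    rw [ih hG hGK]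
    refine lintegral_congr fun h => ?_
    rw [← lintegral_const_mul _ (hφs h)]
    refine lintegral_congr fun r => ?_
    obtain ⟨b, y⟩ := r
    rw [historyLikelihood_snoc, mul_assoc]
    -- Within the quota the truncated factor is the full ratio of the round; beyond it `f` vanishes,
    -- so the truncation does no harm.
    by_cases hq : platformWins j t h + winBid j b ≤ K
    · simp only [φ, hq, and_true]
    · rw [hK (Fin.snoc (α := fun _ => RoundRecord m bidSet) h (b, y))
        (by rw [platformWins_snoc]; omega)]
      simp

theorem lintegral_roundKernel_likelihoodRatio_pow (A : BiddingAlgorithm m bidSet) (t : ℕ)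
    (h : Fin t → RoundRecord m bidSet) (j : Fin m) (k : ℕ) (p : BidVector m bidSet → Prop)
    [DecidablePred p] (hp : ∀ b, p b → winBid j b = 1) (c : BidVector m bidSet → ℝ≥0∞) :
    ∫⁻ r, c r.1 * (if p r.1 then likelihoodRatio (boost m B) (r.2 j).2.2 else 1) ^ k
        ∂((baseInstance T hB hbid).roundKernel A t h) =
      ∫⁻ b, c b * (if p b then
        ENNReal.ofReal (((1 + boost m B) ^ k + (1 - boost m B) ^ k) / 2) else 1)
        ∂(A.policy t h) := by
  have hm : Measurable fun r : RoundRecord m bidSet =>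
      c r.1 * (if p r.1 then likelihoodRatio (boost m B) (r.2 j).2.2 else 1) ^ k :=
    ((Measurable.of_discrete (f := c)).comp measurable_fst).mul
      ((measurable_roundFactor _ p j).pow_const k)
  rw [lintegral_roundKernel _ _ _ _ hm]
  refine lintegral_congr fun b => ?_
  by_cases hb : p b
  · simp only [hb, if_true]
    rw [lintegral_const_mul, lintegral_likelihoodRatio_pow hB hbid (hp b hb)]
    exact ((measurable_likelihoodRatio _).comp (by fun_prop)).pow_const k
  · simp [hb]

theorem lintegral_historyLikelihood_succ_mul (A : BiddingAlgorithm m bidSet) (K : ℕ) (j : Fin m)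
    (t : ℕ) {c : (Fin t → RoundRecord m bidSet) → BidVector m bidSet → ℝ≥0∞}
    (hc : Measurable fun p : (Fin t → RoundRecord m bidSet) × RoundRecord m bidSet =>
      c p.1 p.2.1) (k : ℕ) :
    ∫⁻ h, historyLikelihood (boost m B) K j (t + 1) h ^ k *
        c (Fin.init h) (h (Fin.last t)).1 ∂((baseInstance T hB hbid).historyLaw A (t + 1)) =
      ∫⁻ h, historyLikelihood (boost m B) K j t h ^ k * ∫⁻ b, c h b *
        (if winBid j b = 1 ∧ platformWins j t h + winBid j b ≤ K then
          ENNReal.ofReal (((1 + boost m B) ^ k + (1 - boost m B) ^ k) / 2) else 1)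
        ∂(A.policy t h) ∂((baseInstance T hB hbid).historyLaw A t) := by
  have h1 : Measurable fun h : Fin (t + 1) → RoundRecord m bidSet =>
      c (Fin.init h) (h (Fin.last t)).1 :=
    hc.comp ((measurable_finInit t).prodMk (measurable_pi_apply _))
  rw [lintegral_historyLaw_succ _ _ _
    (show Measurable fun h => historyLikelihood (boost m B) K j (t + 1) h ^ k *
        c (Fin.init h) (h (Fin.last t)).1 from
      ((measurable_historyLikelihood _ K j (t + 1)).pow_const k).mul h1)]
  refine lintegral_congr fun h => ?_
  rw [← lintegral_roundKernel_likelihoodRatio_pow hB hbid A t h j k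
    (fun b => winBid j b = 1 ∧ platformWins j t h + winBid j b ≤ K) (fun b hb => hb.1) (c h),
    ← lintegral_const_mul]
  · refine lintegral_congr fun r => ?_
    obtain ⟨b, y⟩ := r
    simp only [historyLikelihood_snoc, Fin.init_snoc, Fin.snoc_last, mul_pow]
    ring
  · exact ((Measurable.of_discrete (f := c h)).comp measurable_fst).mul
      ((measurable_roundFactor _ (fun b => winBid j b = 1 ∧ platformWins j t h + winBid j b ≤ K)
        j).pow_const k)

/-- The likelihood ratio is a martingale under the base instance, since each factor has conditional
mean `1`. -/
theorem lintegral_historyLikelihood (A : BiddingAlgorithm m bidSet) (K : ℕ) (j : Fin m) (t : ℕ) :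
    ∫⁻ h, historyLikelihood (boost m B) K j t h
      ∂((baseInstance T hB hbid).historyLaw A t) = 1 := by
  induction t with
  | zero => simp [historyLikelihood]
  | succ t ih =>
    have := lintegral_historyLikelihood_succ_mul (T := T) hB hbid A K j t
      (c := fun _ _ => 1) measurable_const 1
    simp only [pow_one, mul_one, one_mul] at this
    refine this.trans (Eq.trans (lintegral_congr fun h => ?_) ih)
    simp

/-- The number of counted wins is random and chosen by the algorithm. The compensating power makes
the expectation constant in `t`: each counted win multiplies the conditional second moment by `1 +
ε²` and uses up one unit of the remaining quota. After `K` wins the truncated subtraction gives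
exponent `0`, matching the factor `1` of the ratio. -/
theorem lintegral_historyLikelihood_sq (A : BiddingAlgorithm m bidSet) (K : ℕ) (j : Fin m)
    (t : ℕ) :
    ∫⁻ h, historyLikelihood (boost m B) K j t h ^ 2 *
        ENNReal.ofReal (1 + boost m B ^ 2) ^ (K - platformWins j t h)
      ∂((baseInstance T hB hbid).historyLaw A t) = ENNReal.ofReal (1 + boost m B ^ 2) ^ K := by
  induction t with
  | zero => simp [historyLikelihood, platformWins]
  | succ t ih =>
    set r := ENNReal.ofReal (1 + boost m B ^ 2) with hr
    have hc : Measurable fun p : (Fin t → RoundRecord m bidSet) × RoundRecord m bidSet =>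
        r ^ (K - (platformWins j t p.1 + winBid j p.2.1)) :=
      (Measurable.of_discrete (f := fun n : ℕ => r ^ (K - n))).comp
        (((measurable_platformWins j t).comp measurable_fst).add
          (measurable_recordBid t (winBid j)))
    refine (lintegral_historyLikelihood_succ_mul (T := T) hB hbid A K j t
      (c := fun h b => r ^ (K - (platformWins j t h + winBid j b))) hc 2).trans ?_
    rw [← ih]
    refine lintegral_congr fun h => ?_
    congr 1
    have h2 : ((1 + boost m B) ^ 2 + (1 - boost m B) ^ 2) / 2 = 1 + boost m B ^ 2 := by ring
    have h3 (b : BidVector m bidSet) : r ^ (K - (platformWins j t h + winBid j b)) *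
        (if winBid j b = 1 ∧ platformWins j t h + winBid j b ≤ K then r else 1) =
        r ^ (K - platformWins j t h) := by
      have := winBid_le_one j b
      split_ifs with hb
      · rw [← pow_succ]; congr 1; omega
      · rw [mul_one]; congr 1; omega
    rw [h2, ← hr]
    simp [h3]

theorem lintegral_historyLikelihood_sq_le (A : BiddingAlgorithm m bidSet) (K : ℕ) (j : Fin m)
    (t : ℕ) :
    ∫⁻ h, historyLikelihood (boost m B) K j t h ^ 2
      ∂((baseInstance T hB hbid).historyLaw A t) ≤ ENNReal.ofReal (1 + boost m B ^ 2) ^ K := by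
  rw [← lintegral_historyLikelihood_sq (T := T) hB hbid A K j t]
  refine lintegral_mono fun h => le_mul_of_one_le_right' (one_le_pow₀ ?_)
  rw [ENNReal.one_le_ofReal]
  nlinarith [sq_nonneg (boost m B)]

/-! ### Transfer of the quota event from the base instance to a boosted one. -/

/-- The indicator that bid vector `b` makes platform `j` exceed its quota of `K` wins. -/
def crossesQuota (S K : ℕ) (j : Fin m) (t : ℕ) (h : Fin t → RoundRecord m bidSet)
    (b : BidVector m bidSet) : ℕ :=
  if totalWins t h + winCount b ≤ S ∧ platformWins j t h = K then winBid j b else 0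

theorem measurable_crossesQuota (S K : ℕ) (j : Fin m) (t : ℕ) :
    Measurable fun p : (Fin t → RoundRecord m bidSet) × BidVector m bidSet =>
      (crossesQuota S K j t p.1 p.2 : ℝ≥0∞) := by
  have hW : Measurable fun p : (Fin t → RoundRecord m bidSet) × BidVector m bidSet =>
      totalWins t p.1 + winCount p.2 :=
    ((measurable_totalWins t).comp measurable_fst).add
      ((Measurable.of_discrete (f := winCount)).comp measurable_snd)
  have hN : Measurable fun p : (Fin t → RoundRecord m bidSet) × BidVector m bidSet =>
      platformWins j t p.1 := (measurable_platformWins j t).comp measurable_fst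
  have hb : Measurable fun p : (Fin t → RoundRecord m bidSet) × BidVector m bidSet =>
      winBid j p.2 := (Measurable.of_discrete (f := winBid j)).comp measurable_snd
  have hset : MeasurableSet {p : (Fin t → RoundRecord m bidSet) × BidVector m bidSet |
      totalWins t p.1 + winCount p.2 ≤ S ∧ platformWins j t p.1 = K} :=
    (hW (MeasurableSet.of_discrete (s := Set.Iic S))).inter (hN (measurableSet_singleton K))
  exact measurable_natCast_ennreal.comp (Measurable.ite hset hb measurable_const)

theorem measurable_crossesQuota_record (S K : ℕ) (j : Fin m) (t : ℕ) :
    Measurable fun p : (Fin t → RoundRecord m bidSet) × RoundRecord m bidSet =>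
      (crossesQuota S K j t p.1 p.2.1 : ℝ≥0∞) := by
  have hN : Measurable fun p : (Fin t → RoundRecord m bidSet) × RoundRecord m bidSet =>
      platformWins j t p.1 := (measurable_platformWins j t).comp measurable_fst
  have hset : MeasurableSet {p : (Fin t → RoundRecord m bidSet) × RoundRecord m bidSet |
      totalWins t p.1 + winCount p.2.1 ≤ S ∧ platformWins j t p.1 = K} :=
    (measurableSet_totalWins_add_le S t).inter (hN (measurableSet_singleton K))
  exact measurable_natCast_ennreal.comp
    (Measurable.ite hset (measurable_recordBid t (winBid j)) measurable_const)

theorem exceedsQuota_succ (S K : ℕ) (j : Fin m) (t : ℕ)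
    (h : Fin (t + 1) → RoundRecord m bidSet) :
    (exceedsQuota S K j (t + 1) h : ℝ≥0∞) =
      exceedsQuota S K j t (Fin.init h) + crossesQuota S K j t (Fin.init h) (h (Fin.last t)).1 := by
  simp only [exceedsQuota, totalWins, crossesQuota, Nat.cast_add]
  rfl

/-- The crossing bid is chosen from a history with exactly `K` wins on platform `j`, which is still
in the range where the truncated ratio is exact. -/
theorem lintegral_crossesQuota (A : BiddingAlgorithm m bidSet) (S K : ℕ) (j : Fin m) (t : ℕ) :
    ∫⁻ h, ∫⁻ b, (crossesQuota S K j t h b : ℝ≥0∞) ∂(A.policy t h)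
        ∂((boostedInstance T hB hbid j).historyLaw A t) =
      ∫⁻ h, historyLikelihood (boost m B) K j t h *
        ∫⁻ b, (crossesQuota S K j t h b : ℝ≥0∞) ∂(A.policy t h)
        ∂((baseInstance T hB hbid).historyLaw A t) := by
  have hm : Measurable fun h : Fin t → RoundRecord m bidSet =>
      ∫⁻ b, (crossesQuota S K j t h b : ℝ≥0∞) ∂(A.policy t h) :=
    Measurable.lintegral_kernel_prod_right' (κ := A.policy t)
      (f := fun p => (crossesQuota S K j t p.1 p.2 : ℝ≥0∞)) (measurable_crossesQuota S K j t)
  refine lintegral_historyLaw_change_measure hB hbid A K j t hm fun h hh => ?_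
  have : platformWins j t h ≠ K := by omega
  simp [crossesQuota, this]

/-- `lintegral_historyLaw_change_measure` does not apply directly, since the indicator lives on
histories with more than `K` wins. It is therefore summed over the possible crossing rounds. -/
theorem lintegral_exceedsQuota (A : BiddingAlgorithm m bidSet) (S K : ℕ) (j : Fin m) (t : ℕ) :
    ∫⁻ h, (exceedsQuota S K j t h : ℝ≥0∞) ∂((boostedInstance T hB hbid j).historyLaw A t) =
      ∫⁻ h, historyLikelihood (boost m B) K j t h * (exceedsQuota S K j t h : ℝ≥0∞)
        ∂((baseInstance T hB hbid).historyLaw A t) := by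
  induction t with
  | zero => simp [exceedsQuota]
  | succ t ih =>
    have hq : Measurable fun h : Fin t → RoundRecord m bidSet => (exceedsQuota S K j t h : ℝ≥0∞) :=
      measurable_natCast_ennreal.comp (measurable_exceedsQuota S K j t)
    have hr (h : Fin t → RoundRecord m bidSet) : Measurable fun r : RoundRecord m bidSet =>
        (crossesQuota S K j t h r.1 : ℝ≥0∞) :=
      (Measurable.of_discrete (f := fun b => (crossesQuota S K j t h b : ℝ≥0∞))).comp
        measurable_fst
    have h1 := lintegral_historyLaw_succ_add (boostedInstance T hB hbid j) A t hq
      (g := fun h r => (crossesQuota S K j t h r.1 : ℝ≥0∞)) (measurable_crossesQuota_record S K j t)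
    have hqr : Measurable fun p : (Fin t → RoundRecord m bidSet) × RoundRecord m bidSet =>
        (exceedsQuota S K j t p.1 : ℝ≥0∞) := hq.comp measurable_fst
    have h2 := lintegral_historyLikelihood_succ_mul (T := T) hB hbid A K j t
      (c := fun h b => (exceedsQuota S K j t h : ℝ≥0∞) + crossesQuota S K j t h b)
      (hqr.add (measurable_crossesQuota_record S K j t)) 1
    have h4 (h : Fin t → RoundRecord m bidSet) :
        ∫⁻ r, (crossesQuota S K j t h r.1 : ℝ≥0∞)
            ∂((boostedInstance T hB hbid j).roundKernel A t h) =
          ∫⁻ b, (crossesQuota S K j t h b : ℝ≥0∞) ∂(A.policy t h) := by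
      rw [lintegral_roundKernel _ _ _ _ (hr h)]
      simp
    -- The last factor of the ratio has conditional mean `1` given the bid, so it drops out.
    have hone : (1 + boost m B + (1 - boost m B)) / 2 = 1 := by ring
    simp only [pow_one, hone, ENNReal.ofReal_one, ite_self, mul_one] at h2
    simp only [h4, lintegral_crossesQuota hB hbid, ih] at h1
    simp only [exceedsQuota_succ]
    have hLq : Measurable fun h => historyLikelihood (boost m B) K j t h *
        (exceedsQuota S K j t h : ℝ≥0∞) := (measurable_historyLikelihood _ K j t).mul hq
    rw [h1, h2, ← lintegral_add_left hLq]
    refine lintegral_congr fun h => ?_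
    rw [lintegral_add_left measurable_const, lintegral_const, measure_univ, mul_one, mul_add]

end BiddingInstance

/-! ### The collected reward -/

theorem totalWins_eq_sum (t : ℕ) (h : Fin t → RoundRecord m bidSet) :
    totalWins t h = ∑ s, winCount (h s).1 := by
  induction t with
  | zero => simp [totalWins]
  | succ t ih => rw [totalWins, ih, Fin.sum_univ_castSucc]; rfl

theorem cappedReward_eq_sum (S t : ℕ) (h : Fin t → RoundRecord m bidSet) :
    cappedReward S t h = ∑ s : Fin t,
      if ∑ u : Fin t, (if (u : ℕ) + 1 ≤ (s : ℕ) + 1 then winCount (h u).1 else 0) ≤ S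
        then ENNReal.ofReal (roundReward (h s).2) else 0 := by
  induction t with
  | zero => simp [cappedReward]
  | succ t ih =>
    rw [cappedReward, ih, Fin.sum_univ_castSucc, totalWins_eq_sum]
    congr 1
    · refine Finset.sum_congr rfl fun s _ => ?_
      rw [Fin.sum_univ_castSucc]
      have hs : ¬ t + 1 ≤ (s : ℕ) + 1 := by have := s.2; omega
      simp only [Fin.val_castSucc, Fin.val_last, hs, if_false, add_zero]
      rfl
    · have hu (u : Fin (t + 1)) : (u : ℕ) + 1 ≤ t + 1 := u.2
      simp only [Fin.val_last, hu, if_true]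

theorem cappedReward_ne_top (S t : ℕ) (h : Fin t → RoundRecord m bidSet) :
    cappedReward S t h ≠ ∞ := by
  rw [cappedReward_eq_sum]
  refine ENNReal.sum_ne_top.2 fun s _ => ?_
  split_ifs <;> simp

theorem ValidRecord.roundCost_eq {r : RoundRecord m bidSet} (hr : ValidRecord r) :
    roundCost r.2 = winCount r.1 / 2 := by
  unfold roundCost winCount
  rw [Nat.cast_sum, Finset.sum_div]
  refine Finset.sum_congr rfl fun i _ => ?_
  rcases hr i with ⟨hw, hf, hp, _⟩ | ⟨hw, hf⟩
  · rw [hf, if_pos rfl, hp, winBid, if_pos hw]; norm_num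
  · rw [hf, winBid, if_neg hw]; simp

theorem ValidRecord.roundReward_nonneg {r : RoundRecord m bidSet} (hr : ValidRecord r) :
    0 ≤ roundReward r.2 := by
  refine Finset.sum_nonneg fun i _ => ?_
  rcases hr i with ⟨_, hf, _, hv⟩ | ⟨_, hf⟩
  · rw [hf, if_pos rfl]; exact hv.1
  · rw [hf]; simp

namespace BiddingInstance

/-- With nonnegative costs the cumulative cost is monotone, so not having stopped yet is a condition
on the current round alone. -/
theorem lt_stoppingTime_iff (I : BiddingInstance m T bidSet) (h : Fin T → RoundRecord m bidSet)
    (hcost : ∀ s, 0 ≤ roundCost (h s).2) (s : Fin T) :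
    (s : ℕ) + 1 < I.stoppingTime h ↔
      ∑ u : Fin T, (if (u : ℕ) + 1 ≤ (s : ℕ) + 1 then roundCost (h u).2 else 0) ≤ I.budget := by
  unfold stoppingTime
  constructor
  · intro hlt
    by_contra hgt
    refine absurd hlt (not_lt.2 (Nat.sInf_le (Or.inr ⟨⟨by omega, s.2⟩, not_le.1 hgt⟩)))
  · intro hle
    have hmem := Nat.sInf_mem (s := {T + 1} ∪ {z | z ∈ Set.Icc 1 T ∧
      I.budget < ∑ t : Fin T, if (t : ℕ) + 1 ≤ z then roundCost (h t).2 else 0})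
      ⟨T + 1, Or.inl rfl⟩
    rcases hmem with hT | ⟨_, hz⟩
    · rw [Set.mem_singleton_iff.1 hT]; have := s.2; omega
    · by_contra hlt
      refine absurd (hz.trans_le (le_trans (Finset.sum_le_sum fun u _ => ?_) hle)) (lt_irrefl _)
      split_ifs with h1 h2 h2
      · exact le_rfl
      · exact absurd (h1.trans (not_lt.1 hlt)) h2
      · exact hcost u
      · exact le_rfl

/-- The cost is half the number of wins, so staying within the budget means at most `T` wins. Hence
`T` serves both as horizon and as cap. -/
theorem totalReward_eq_toReal_cappedReward (I : BiddingInstance m T bidSet)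
    (hT : (T : ℝ) = 2 * I.budget)
    (h : Fin T → RoundRecord m bidSet) (hv : ∀ s, ValidRecord (h s)) :
    I.totalReward h = (cappedReward T T h).toReal := by
  rw [cappedReward_eq_sum, ENNReal.toReal_sum fun s _ => by split_ifs <;> simp]
  refine Finset.sum_congr rfl fun s _ => ?_
  have hcost (u : Fin T) : 0 ≤ roundCost (h u).2 := by rw [(hv u).roundCost_eq]; positivity
  have hiff : (s : ℕ) + 1 < I.stoppingTime h ↔
      ∑ u : Fin T, (if (u : ℕ) + 1 ≤ (s : ℕ) + 1 then winCount (h u).1 else 0) ≤ T := by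
    rw [lt_stoppingTime_iff I h hcost, ← Nat.cast_le (α := ℝ), Nat.cast_sum, hT]
    have : ∑ u : Fin T, (if (u : ℕ) + 1 ≤ (s : ℕ) + 1 then roundCost (h u).2 else 0) =
        (∑ u : Fin T, ((if (u : ℕ) + 1 ≤ (s : ℕ) + 1 then winCount (h u).1 else 0 : ℕ) : ℝ)) / 2 := by
      rw [Finset.sum_div]
      refine Finset.sum_congr rfl fun u _ => ?_
      split_ifs
      · exact (hv u).roundCost_eq
      · simp
    rw [this]
    constructor <;> intro <;> linarith
  simp only [hiff]
  split_ifs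
  · rw [ENNReal.toReal_ofReal (hv s).roundReward_nonneg]
  · simp

theorem ae_historyLaw (I : BiddingInstance m T bidSet) (A : BiddingAlgorithm m bidSet)
    {P : RoundRecord m bidSet → Prop} (hP : MeasurableSet {r | P r})
    (hr : ∀ t h, ∀ᵐ r ∂(I.roundKernel A t h), P r) (t : ℕ) :
    ∀ᵐ h ∂(I.historyLaw A t), ∀ s, P (h s) := by
  have hmeas (t : ℕ) : MeasurableSet {h : Fin t → RoundRecord m bidSet | ∀ s, P (h s)} := by
    simp only [Set.ofPred_forall]
    exact MeasurableSet.iInter fun s => measurable_pi_apply s hP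
  induction t with
  | zero => exact Filter.Eventually.of_forall fun h s => s.elim0
  | succ t ih =>
    rw [historyLaw_succ, ae_map_iff (measurable_finSnoc t).aemeasurable (hmeas (t + 1))]
    refine Measure.ae_compProd_of_ae_ae ((measurable_finSnoc t) (hmeas (t + 1))) ?_
    filter_upwards [ih] with h hh
    filter_upwards [hr t h] with r hr s
    refine Fin.lastCases ?_ (fun s => ?_) s
    · simpa using hr
    · simpa using hh s

theorem ae_roundKernel (I : BiddingInstance m T bidSet) (A : BiddingAlgorithm m bidSet)
    (t : ℕ) (h : Fin t → RoundRecord m bidSet) {P : RoundRecord m bidSet → Prop}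
    (hP : MeasurableSet {r | P r})
    (hr : ∀ᵐ b ∂(A.policy t h), ∀ᵐ y ∂(I.feedbackKernel b), P (b, y)) :
    ∀ᵐ r ∂(I.roundKernel A t h), P r :=
  Kernel.ae_compProd_of_ae_ae hP hr

theorem ae_historyLaw_validRecord (hB : 0 ≤ B) (hbid : ∀ b ∈ bidSet, b ∈ Set.Icc (0 : ℝ) 1)
    (μ : Fin m → unitInterval) (A : BiddingAlgorithm m bidSet) (t : ℕ) :
    ∀ᵐ h ∂((bernoulliInstance T hB hbid μ).historyLaw A t), ∀ s, ValidRecord (h s) :=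
  ae_historyLaw _ _ measurableSet_validRecord (fun _ _ =>
    ae_roundKernel _ _ _ _ measurableSet_validRecord
      (Filter.Eventually.of_forall fun b => ae_validRecord hB hbid μ b)) t

theorem cappedWins_le (S : ℕ) (j : Fin m) (t : ℕ) (h : Fin t → RoundRecord m bidSet) :
    cappedWins S j t h ≤ S :=
  (Finset.single_le_sum (f := fun j => cappedWins S j t h) (fun _ _ => Nat.zero_le _)
    (Finset.mem_univ j)).trans (sum_cappedWins_le S t h)

theorem measurable_natCast_real {α : Type*} [MeasurableSpace α] {f : α → ℕ} (hf : Measurable f) :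
    Measurable fun h => (f h : ℝ) :=
  (Measurable.of_discrete (f := fun n : ℕ => (n : ℝ))).comp hf

theorem integrable_natCast {α : Type*} [MeasurableSpace α] {μ : Measure α} [IsFiniteMeasure μ]
    {f : α → ℕ} (hf : Measurable f) {C : ℕ} (hC : ∀ h, f h ≤ C) :
    Integrable (fun h => (f h : ℝ)) μ :=
  Integrable.of_bound (measurable_natCast_real hf).aestronglyMeasurable (C := (C : ℝ))
    (Filter.Eventually.of_forall fun h => by simpa using hC h)

theorem integrable_cappedWins (I : BiddingInstance m T bidSet) (A : BiddingAlgorithm m bidSet)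
    (S : ℕ) (j : Fin m) (t : ℕ) :
    Integrable (fun h => (cappedWins S j t h : ℝ)) (I.historyLaw A t) :=
  integrable_natCast (measurable_cappedWins S j t) (cappedWins_le S j t)

theorem integrable_exceedsQuota (I : BiddingInstance m T bidSet) (A : BiddingAlgorithm m bidSet)
    (S K : ℕ) (j : Fin m) (t : ℕ) :
    Integrable (fun h => (exceedsQuota S K j t h : ℝ)) (I.historyLaw A t) :=
  integrable_natCast (measurable_exceedsQuota S K j t) (exceedsQuota_le_one S K j t)

theorem expectedReward_eq (hB : 0 ≤ B) (hbid : ∀ b ∈ bidSet, b ∈ Set.Icc (0 : ℝ) 1)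
    (hT : (T : ℝ) = 2 * B) (μ : Fin m → unitInterval) (A : BiddingAlgorithm m bidSet) :
    (bernoulliInstance T hB hbid μ).expectedReward A =
      ∫ h, ∑ i, (μ i : ℝ) * (cappedWins T i T h : ℝ)
        ∂((bernoulliInstance T hB hbid μ).historyLaw A T) := by
  set I := bernoulliInstance T hB hbid μ with hI
  have h1 : I.expectedReward A = ∫ h, (cappedReward T T h).toReal ∂(I.historyLaw A T) := by
    refine integral_congr_ae ?_
    filter_upwards [ae_historyLaw_validRecord (T := T) hB hbid μ A T] with h hh
    exact totalReward_eq_toReal_cappedReward I hT h hh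
  have h2 (h : Fin T → RoundRecord m bidSet) :
      ∑ i, (μ i : ℝ) * (cappedWins T i T h : ℝ) =
        (∑ i, ENNReal.ofReal (μ i) * (cappedWins T i T h : ℝ≥0∞)).toReal := by
    rw [ENNReal.toReal_sum fun i _ => ENNReal.mul_ne_top (by simp) (by simp)]
    refine Finset.sum_congr rfl fun i _ => ?_
    rw [ENNReal.toReal_mul, ENNReal.toReal_ofReal (μ i).2.1, ENNReal.toReal_natCast]
  have hm : Measurable fun h : Fin T → RoundRecord m bidSet =>
      ∑ i, ENNReal.ofReal (μ i) * (cappedWins T i T h : ℝ≥0∞) :=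
    Finset.measurable_sum _ fun i _ =>
      (measurable_natCast_ennreal.comp (measurable_cappedWins T i T)).const_mul _
  simp only [h2]
  rw [h1, integral_toReal (measurable_cappedReward T T).aemeasurable
      (Filter.Eventually.of_forall fun h => (cappedReward_ne_top T T h).lt_top),
    integral_toReal hm.aemeasurable (Filter.Eventually.of_forall fun h => ?_),
    lintegral_cappedReward hB hbid μ A T T]
  exact ENNReal.sum_lt_top.2 fun i _ => ENNReal.mul_lt_top (by simp) (by simp)

/-! ### Upper bound on the reward and the value of `OPT`. -/

variable (hB : (m : ℝ) ≤ B) (hbid : ∀ b ∈ bidSet, b ∈ Set.Icc (0 : ℝ) 1)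

/-- At most `T = 2B` paid wins are worth `1/2` each, and those on platform `j` earn `ε/2` more. -/
theorem expectedReward_boostedInstance_le (hT : (T : ℝ) = 2 * B) (j : Fin m)
    (A : BiddingAlgorithm m bidSet) :
    (boostedInstance T hB hbid j).expectedReward A ≤ B + boost m B / 2 *
      ∫ h, (cappedWins T j T h : ℝ) ∂((boostedInstance T hB hbid j).historyLaw A T) := by
  have hε := boost_mem hB
  rw [boostedInstance_eq, expectedReward_eq _ _ hT, ← integral_const_mul]
  set I := bernoulliInstance T ((Nat.cast_nonneg m).trans hB) hbid (boostedMean hB j)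
  have hconst : ∫ _, B ∂(I.historyLaw A T) = B := by simp
  refine le_of_le_of_eq ?_ (congrArg (· + _) hconst)
  rw [← integral_add (integrable_const _) ((integrable_cappedWins I A T j T).const_mul _)]
  refine integral_mono (integrable_finsetSum _ fun i _ =>
    (integrable_cappedWins I A T i T).const_mul _) ((integrable_const _).add
    ((integrable_cappedWins I A T j T).const_mul _)) fun h => ?_
  have hmean (i : Fin m) : ((boostedMean hB j i : unitInterval) : ℝ) * (cappedWins T i T h : ℝ) =
      1 / 2 * (cappedWins T i T h : ℝ) +
        if i = j then boost m B / 2 * (cappedWins T j T h : ℝ) else 0 := by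
    simp only [boostedMean]
    split_ifs with hij
    · rw [hij]; ring
    · ring
  simp only [hmean, Finset.sum_add_distrib, Finset.sum_ite_eq', Finset.mem_univ, if_true,
    ← Finset.mul_sum]
  have := sum_cappedWins_le T T h
  rw [← Nat.cast_le (α := ℝ), Nat.cast_sum] at this
  linarith

/-- The algorithm that submits the same bid vector in every round. -/
def constantAlgorithm (b : BidVector m bidSet) : BiddingAlgorithm m bidSet where
  policy := fun _ => Kernel.const _ (Measure.dirac b)
  policy_markov := fun _ => inferInstance

theorem ae_historyLaw_constantAlgorithm (I : BiddingInstance m T bidSet) (b : BidVector m bidSet)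
    (t : ℕ) : ∀ᵐ h ∂(I.historyLaw (constantAlgorithm b) t), ∀ s, (h s).1 = b := by
  have hP : MeasurableSet {r : RoundRecord m bidSet | r.1 = b} :=
    measurable_fst (measurableSet_singleton b)
  refine ae_historyLaw I _ hP (fun t h => ae_roundKernel I _ t h hP ?_) t
  change ∀ᵐ b' ∂(Measure.dirac b), _
  rw [ae_dirac_eq]
  change ∀ᵐ y ∂(I.feedbackKernel b), (b, y).1 = b
  exact Filter.Eventually.of_forall fun _ => rfl

theorem cappedWins_eq_of_bid_eq {b : BidVector m bidSet} {j : Fin m} (hw : winBid j b = 1)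
    (hc : winCount b = 1) {S : ℕ} (t : ℕ) (ht : t ≤ S) (h : Fin t → RoundRecord m bidSet)
    (hb : ∀ s, (h s).1 = b) : cappedWins S j t h = t := by
  induction t with
  | zero => rfl
  | succ t ih =>
    have hW : totalWins (t + 1) h ≤ S := by
      simp only [totalWins_eq_sum, hb, hc]
      simpa using ht
    rw [cappedWins, if_pos hW, hb, hw, ih (by omega) (Fin.init h) fun s => hb s.castSucc]

theorem opt_boostedInstance (hT : (T : ℝ) = 2 * B) (hlo : ∃ b ∈ bidSet, b < 1 / 2)
    (hhi : ∃ b ∈ bidSet, 1 / 2 ≤ b) (j : Fin m) :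
    (boostedInstance T hB hbid j).opt = (1 + boost m B) * B := by
  have hε := boost_mem hB
  have hle (A : BiddingAlgorithm m bidSet) :
      (boostedInstance T hB hbid j).expectedReward A ≤ (1 + boost m B) * B := by
    refine (expectedReward_boostedInstance_le hB hbid hT j A).trans ?_
    have h1 : ∫ h, (cappedWins T j T h : ℝ) ∂((boostedInstance T hB hbid j).historyLaw A T) ≤
        ∫ _, (T : ℝ) ∂((boostedInstance T hB hbid j).historyLaw A T) :=
      integral_mono (integrable_cappedWins _ A T j T) (integrable_const _)
        fun h => Nat.cast_le.2 (cappedWins_le T j T h)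
    rw [integral_const, probReal_univ, one_smul, hT] at h1
    nlinarith [hε.1]
  obtain ⟨lo, hlo, hlo'⟩ := hlo
  obtain ⟨hi, hhi, hhi'⟩ := hhi
  -- Winning platform `j` alone in every round gives `T` wins, which exhaust the budget without
  -- exceeding it.
  let b : BidVector m bidSet := fun i => if i = j then ⟨hi, hhi⟩ else ⟨lo, hlo⟩
  have hwin (i : Fin m) : winBid i b = if i = j then 1 else 0 := by
    unfold winBid
    by_cases hij : i = j
    · simp only [b, hij, if_true]; rw [if_pos hhi']
    · simp only [b, hij, if_false]; rw [if_neg (not_le.2 hlo')]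
  have hcount : winCount b = 1 := by simp [winCount, hwin]
  have hge : (1 + boost m B) * B ≤
      (boostedInstance T hB hbid j).expectedReward (constantAlgorithm b) := by
    rw [boostedInstance_eq, expectedReward_eq _ _ hT]
    set I := bernoulliInstance T ((Nat.cast_nonneg m).trans hB) hbid (boostedMean hB j) with hI
    have hconst : (1 + boost m B) * B =
        ∫ _, (1 + boost m B) * B ∂(I.historyLaw (constantAlgorithm b) T) := by simp
    rw [hconst]
    refine integral_mono_ae (integrable_const _) (integrable_finsetSum _ fun i _ =>
      (integrable_cappedWins I _ T i T).const_mul _) ?_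
    filter_upwards [ae_historyLaw_constantAlgorithm I b T] with h hh
    have hj := cappedWins_eq_of_bid_eq (by rw [hwin, if_pos rfl]) hcount T le_rfl h hh
    have hmean : ((boostedMean hB j j : unitInterval) : ℝ) = 1 / 2 * (1 + boost m B) := if_pos rfl
    have h1 := Finset.single_le_sum (f := fun i : Fin m =>
      ((boostedMean hB j i : unitInterval) : ℝ) * (cappedWins T i T h : ℝ))
      (fun i _ => mul_nonneg (boostedMean hB j i).2.1 (Nat.cast_nonneg _)) (Finset.mem_univ j)
    simp only [hj, hmean, hT] at h1
    refine le_trans (le_of_eq ?_) h1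
    ring
  have : Nonempty (BiddingAlgorithm m bidSet) := ⟨constantAlgorithm b⟩
  exact le_antisymm (ciSup_le hle)
    (hge.trans (le_ciSup (f := fun A => (boostedInstance T hB hbid j).expectedReward A)
      ⟨_, Set.forall_mem_range.2 hle⟩ (constantAlgorithm b)))

/-! ### The lower bound -/

/-- The difference of the two probabilities is `E[(D - 1) Q]` under the base instance, bounded
through the variance of `D`, which is at most `1/32`. -/
theorem integral_exceedsQuota_le (A : BiddingAlgorithm m bidSet) (S K : ℕ) (j : Fin m) (t : ℕ)
    (hK : (1 + boost m B ^ 2) ^ K ≤ 33 / 32) :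
    ∫ h, (exceedsQuota S K j t h : ℝ) ∂((boostedInstance T hB hbid j).historyLaw A t) ≤
      ∫ h, (exceedsQuota S K j t h : ℝ) ∂((baseInstance T hB hbid).historyLaw A t) + 3 / 16 := by
  have hreal (I : BiddingInstance m T bidSet) :
      ∫⁻ h, (exceedsQuota S K j t h : ℝ≥0∞) ∂(I.historyLaw A t) =
        ENNReal.ofReal (∫ h, (exceedsQuota S K j t h : ℝ) ∂(I.historyLaw A t)) := by
    rw [ofReal_integral_eq_lintegral_ofReal (integrable_exceedsQuota I A S K j t)
      (Filter.Eventually.of_forall fun h => Nat.cast_nonneg _)]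
    simp
  have hnonneg (I : BiddingInstance m T bidSet) :
      0 ≤ ∫ h, (exceedsQuota S K j t h : ℝ) ∂(I.historyLaw A t) :=
    integral_nonneg fun h => Nat.cast_nonneg _
  -- This is `16 (d - 1) q ≤ 64 (d - 1)² + 1`, from `(8 (d - 1) - q)² ≥ 0` and `q² ≤ 1`, rearranged
  -- without subtraction. Integrating gives `4/32 + 1/16 = 3/16`.
  have hpoint (d : ℝ≥0∞) (q : ℕ) (hq : q ≤ 1) :
      16 * (d * q) + 128 * d ≤ 16 * q + 65 + 64 * d ^ 2 := by
    rcases eq_or_ne d ∞ with rfl | hd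
    · simp
    · lift d to NNReal using hd
      norm_cast
      rw [← NNReal.coe_le_coe]
      push_cast
      obtain rfl | rfl : q = 0 ∨ q = 1 := by omega
      · push_cast; nlinarith [sq_nonneg ((d : ℝ) - 1)]
      · push_cast; nlinarith [sq_nonneg ((d : ℝ) - 9 / 8)]
  have hD : Measurable (historyLikelihood (bidSet := bidSet) (boost m B) K j t) :=
    measurable_historyLikelihood _ K j t
  have hQ : Measurable fun h : Fin t → RoundRecord m bidSet => (exceedsQuota S K j t h : ℝ≥0∞) :=
    measurable_natCast_ennreal.comp (measurable_exceedsQuota S K j t)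
  have hDQ : Measurable fun h => historyLikelihood (boost m B) K j t h *
      (exceedsQuota S K j t h : ℝ≥0∞) := hD.mul hQ
  have hint := lintegral_mono (μ := (baseInstance T hB hbid).historyLaw A t) fun h =>
    hpoint (historyLikelihood (boost m B) K j t h) (exceedsQuota S K j t h)
      (exceedsQuota_le_one S K j t h)
  rw [lintegral_add_right _ (hD.const_mul _), lintegral_add_right _ ((hD.pow_const 2).const_mul _),
    lintegral_add_right _ measurable_const, lintegral_const_mul _ hD,
    lintegral_const_mul _ (hD.pow_const 2), lintegral_const_mul _ hQ,
    lintegral_const_mul _ hDQ] at hint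
  have hsq := (lintegral_historyLikelihood_sq_le (T := T) hB hbid A K j t).trans
    ((ENNReal.ofReal_pow (by positivity) K).symm.le.trans (ENNReal.ofReal_le_ofReal hK))
  have hint' := hint.trans (add_le_add_right (mul_le_mul_right hsq 64) _)
  rw [← lintegral_exceedsQuota hB hbid, hreal, hreal, lintegral_historyLikelihood, lintegral_const,
    measure_univ] at hint'
  have hmul (c x : ℝ) (hc : 0 ≤ c) : ENNReal.ofReal c * ENNReal.ofReal x = ENNReal.ofReal (c * x) :=
    (ENNReal.ofReal_mul hc).symm
  have h16 : (16 : ℝ≥0∞) = ENNReal.ofReal 16 := by simp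
  have h64 : (64 : ℝ≥0∞) = ENNReal.ofReal 64 := by simp
  have h65 : (65 : ℝ≥0∞) = ENNReal.ofReal 65 := by simp
  have h128 : (128 : ℝ≥0∞) = ENNReal.ofReal 128 := by simp
  have hx := hnonneg (boostedInstance T hB hbid j)
  have hy := hnonneg (baseInstance T hB hbid)
  rw [mul_one, mul_one, h16, h64, h65, h128, hmul _ _ (by norm_num), hmul _ _ (by norm_num),
    hmul _ _ (by norm_num), ← ENNReal.ofReal_add (by positivity) (by norm_num),
    ← ENNReal.ofReal_add (by positivity) (by norm_num),
    ← ENNReal.ofReal_add (by positivity) (by norm_num),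
    ENNReal.ofReal_le_ofReal_iff (by positivity)] at hint'
  linarith

/-- Each platform exceeding its quota uses at least `K + 1` of the at most `S` counted wins. -/
theorem sum_integral_exceedsQuota_le (I : BiddingInstance m T bidSet)
    (A : BiddingAlgorithm m bidSet) (S K t : ℕ) :
    (K + 1) * ∑ j, ∫ h, (exceedsQuota S K j t h : ℝ) ∂(I.historyLaw A t) ≤ S := by
  rw [← integral_finsetSum _ fun j _ => integrable_exceedsQuota I A S K j t, ← integral_const_mul]
  have hS : (S : ℝ) = ∫ _, (S : ℝ) ∂(I.historyLaw A t) := by simp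
  rw [hS]
  refine integral_mono ((integrable_finsetSum _ fun j _ =>
    integrable_exceedsQuota I A S K j t).const_mul _) (integrable_const _) fun h => ?_
  have h1 : (K + 1) * ∑ j, exceedsQuota S K j t h ≤ S := by
    rw [Finset.mul_sum]
    exact (Finset.sum_le_sum fun j _ => exceedsQuota_le S K j t h).trans (sum_cappedWins_le S t h)
  exact_mod_cast h1

theorem integral_cappedWins_add_le (I : BiddingInstance m T bidSet)
    (A : BiddingAlgorithm m bidSet) {S K L U : ℕ} (hK : L + K ≤ S) (hU : L + S ≤ U) (j : Fin m)
    (t : ℕ) :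
    ∫ h, (cappedWins U j t h : ℝ) ∂(I.historyLaw A t) + L ≤
      U + L * ∫ h, (exceedsQuota S K j t h : ℝ) ∂(I.historyLaw A t) := by
  have hconst (c : ℝ) : ∫ _, c ∂(I.historyLaw A t) = c := by simp
  rw [← integral_const_mul, ← hconst L, ← hconst U,
    ← integral_add (integrable_cappedWins I A U j t) (integrable_const _),
    ← integral_add (integrable_const _) ((integrable_exceedsQuota I A S K j t).const_mul _)]
  simp only [hconst]
  refine integral_mono ((integrable_cappedWins I A U j t).add (integrable_const _))
    ((integrable_const _).add ((integrable_exceedsQuota I A S K j t).const_mul _)) fun h => ?_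
  exact_mod_cast cappedWins_add_le hK hU j t h

theorem sum_regret_ge (hT : (T : ℝ) = 2 * B) (hlo : ∃ b ∈ bidSet, b < 1 / 2)
    (hhi : ∃ b ∈ bidSet, 1 / 2 ≤ b) (A : BiddingAlgorithm m bidSet) {S K L : ℕ} (hK : L + K ≤ S)
    (hU : L + S ≤ T) (hpow : (1 + boost m B ^ 2) ^ K ≤ 33 / 32)
    (hS : (S : ℝ) ≤ 3 / 4 * m * (K + 1)) :
    m * (boost m B * L / 32) ≤ ∑ j, (boostedInstance T hB hbid j).regret A := by
  have hε := (boost_mem hB).1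
  set ε := boost m B with hεdef
  let x : Fin m → ℝ := fun j =>
    ∫ h, (exceedsQuota S K j T h : ℝ) ∂((boostedInstance T hB hbid j).historyLaw A T)
  -- The base instance contributes `3/4` on average and the change of measure `3/16`.
  have hx : ∑ j, x j ≤ 15 / 16 * m := by
    have h1 : ∑ j, x j ≤ ∑ j : Fin m, (∫ h, (exceedsQuota S K j T h : ℝ)
        ∂((baseInstance T hB hbid).historyLaw A T) + 3 / 16) :=
      Finset.sum_le_sum fun j _ => integral_exceedsQuota_le hB hbid A S K j T hpow
    have h2 := (sum_integral_exceedsQuota_le (baseInstance T hB hbid) A S K T).trans hS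
    rw [mul_comm] at h2
    have h3 := le_of_mul_le_mul_right h2 (by positivity)
    rw [Finset.sum_add_distrib] at h1
    simp only [Finset.sum_const, Finset.card_univ, Fintype.card_fin, nsmul_eq_mul] at h1
    linarith
  have hreg (j : Fin m) : ε * L / 2 * (1 - x j) ≤ (boostedInstance T hB hbid j).regret A := by
    have h1 := expectedReward_boostedInstance_le hB hbid hT j A
    have h2 := integral_cappedWins_add_le (boostedInstance T hB hbid j) A hK hU j T
    rw [regret, opt_boostedInstance hB hbid hT hlo hhi j]
    have h3 := mul_le_mul_of_nonneg_left h2 (by positivity : 0 ≤ ε / 2)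
    simp only [x]
    rw [hT] at h3
    linarith
  refine le_trans ?_ (Finset.sum_le_sum fun j _ => hreg j)
  rw [← Finset.mul_sum, Finset.sum_sub_distrib]
  simp only [Finset.sum_const, Finset.card_univ, Fintype.card_fin, nsmul_eq_mul, mul_one]
  have h4 : 0 ≤ ε * L / 2 := by positivity
  nlinarith [mul_le_mul_of_nonneg_left hx h4]

end BiddingInstance

/-! ### Choice of the thresholds and final constants. -/

theorem exists_thresholds {m T : ℕ} {B : ℝ} (hm : 2 ≤ m) (hB : (m : ℝ) ≤ B)
    (hT : (T : ℝ) = 2 * B) :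
    ∃ S K L : ℕ, L + K ≤ S ∧ L + S ≤ T ∧ (1 + boost m B ^ 2) ^ K ≤ 33 / 32 ∧
      (S : ℝ) ≤ 3 / 4 * m * (K + 1) ∧ B / 256 ≤ L := by
  have hm' : (2 : ℝ) ≤ m := by exact_mod_cast hm
  have hB0 : 0 < B := by linarith
  -- Taking `K + 1` as the ceiling puts `K` strictly below `B/(64m)`, hence `K ε² ≤ 1/64`, and `K +
  -- 1` at or above it. The value `K = 0` is allowed.
  obtain ⟨K, hK⟩ : ∃ K, ⌈B / (64 * m)⌉₊ = K + 1 :=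
    Nat.exists_eq_succ_of_ne_zero (Nat.ceil_pos.2 (by positivity)).ne'
  have hceil : B / (64 * m) ≤ K + 1 := by
    have := Nat.le_ceil (B / (64 * m))
    rw [hK] at this
    exact_mod_cast this
  have hlt : (K : ℝ) < B / (64 * m) := by
    have := Nat.ceil_lt_add_one (a := B / (64 * m)) (by positivity)
    rw [hK] at this
    push_cast at this
    linarith
  rw [div_le_iff₀ (by positivity)] at hceil
  rw [lt_div_iff₀ (by positivity)] at hlt
  obtain ⟨S, hS⟩ : ∃ S, S = 3 * m * (K + 1) / 4 := ⟨_, rfl⟩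
  have hS1 : (4 : ℝ) * S ≤ 3 * m * (K + 1) := by
    have : 4 * S ≤ 3 * m * (K + 1) := by omega
    exact_mod_cast this
  have hS2 : (3 : ℝ) * m * (K + 1) ≤ 4 * S + 3 := by
    have : 3 * m * (K + 1) ≤ 4 * S + 3 := by omega
    exact_mod_cast this
  have hKS : K ≤ S := by
    rw [← Nat.cast_le (α := ℝ)]
    nlinarith [mul_le_mul_of_nonneg_right hm' (Nat.cast_nonneg (α := ℝ) K)]
  -- Since `m ≥ 2`, `K ≤ mK/2`, so `S - K` is at least `m(K+1)/4 ≥ B/256`, the rounding loss in `S`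
  -- included.
  refine ⟨S, K, S - K, by omega, ?_, ?_, by linarith, ?_⟩
  · have h2 : 2 * S ≤ T := by
      rw [← Nat.cast_le (α := ℝ)]
      push_cast
      rw [hT]
      nlinarith
    omega
  · have h1 : (1 + boost m B ^ 2) ^ K ≤ Real.exp (boost m B ^ 2) ^ K :=
      pow_le_pow_left₀ (by positivity) (by linarith [Real.add_one_le_exp (boost m B ^ 2)]) K
    rw [← Real.exp_nat_mul] at h1
    have h2 : (K : ℝ) * boost m B ^ 2 ≤ 1 / 64 := by
      rw [boost, Real.sq_sqrt (by positivity), ← mul_div_assoc, div_le_iff₀ hB0]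
      linarith
    have h3 := Real.exp_le_exp.2 h2
    have h4 := Real.add_one_le_exp (-(1 / 64 : ℝ))
    rw [Real.exp_neg] at h4
    have h5 : Real.exp (1 / 64) ≤ 64 / 63 := by
      rw [← inv_inv (Real.exp (1 / 64))]
      refine inv_le_of_inv_le₀ (by norm_num) (le_trans (by norm_num) h4)
    linarith
  · rw [Nat.cast_sub hKS]
    nlinarith [mul_le_mul_of_nonneg_right hm' (Nat.cast_nonneg (α := ℝ) K)]

/-- By the choice of `ε`, `m = ε² B`, so `√(mB) = εB`; the factor `1 + ε ≤ 2` is absorbed by the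
constant. -/
theorem sqrt_mul_opt_le {m : ℕ} {B : ℝ} (hm : 2 ≤ m) (hB : (m : ℝ) ≤ B) :
    √(m * ((1 + √(m / B)) * B)) ≤ 2 * (boost m B * B) := by
  have hm' : (2 : ℝ) ≤ m := by exact_mod_cast hm
  have hB0 : 0 < B := by linarith
  have hε := boost_mem hB
  have hsq : boost m B ^ 2 * B = m := by
    rw [boost, Real.sq_sqrt (by positivity), div_mul_cancel₀ _ hB0.ne']
  refine Real.sqrt_le_iff.2 ⟨by have := hε.1; positivity, ?_⟩
  change m * ((1 + boost m B) * B) ≤ _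
  have : (2 * (boost m B * B)) ^ 2 = 4 * (m * B) := by rw [← hsq]; ring
  rw [this]
  nlinarith [mul_le_mul_of_nonneg_left hε.2 (show 0 ≤ m * B by positivity)]

end

theorem theorem3 :
    ∃ c : ℝ, 0 < c ∧
      ∀ (m T : ℕ) (B : ℝ) (_ : 2 ≤ m) (hB : (m : ℝ) ≤ B) (_ : (T : ℝ) = 2 * B)
        (bidSet : Finset ℝ) (hbid : ∀ b ∈ bidSet, b ∈ Set.Icc (0 : ℝ) 1)
        (_ : ∃ b ∈ bidSet, b < 1 / 2) (_ : ∃ b ∈ bidSet, 1 / 2 ≤ b),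
        (∀ j : Fin m, (boostedInstance T hB hbid j).opt = (1 + √(m / B)) * B) ∧
        ∀ A : BiddingAlgorithm m bidSet,
          (c * √(m * ((1 + √(m / B)) * B)) ≤
            1 / m * ∑ j : Fin m, (boostedInstance T hB hbid j).regret A) ∧
          ∃ j : Fin m, c * √(m * (boostedInstance T hB hbid j).opt) ≤
            (boostedInstance T hB hbid j).regret A := by
  -- The constant is `1/(2 · 32 · 256)`: `2` from `sqrt_mul_opt_le`, `32` from `sum_regret_ge`,
  -- `256` from the bound on `L`.
  refine ⟨1 / 16384, by norm_num, fun m T B hm hB hT bidSet hbid hlo hhi => ?_⟩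
  have hopt (j : Fin m) : (boostedInstance T hB hbid j).opt = (1 + √(m / B)) * B :=
    BiddingInstance.opt_boostedInstance hB hbid hT hlo hhi j
  refine ⟨hopt, fun A => ?_⟩
  obtain ⟨S, K, L, hK, hU, hpow, hS, hL⟩ := exists_thresholds hm hB hT
  have hm0 : (0 : ℝ) < m := by exact_mod_cast (by omega : 0 < m)
  have hsum := BiddingInstance.sum_regret_ge hB hbid hT hlo hhi A hK hU hpow hS
  have hbound : 1 / 16384 * √(m * ((1 + √(m / B)) * B)) ≤ boost m B * L / 32 := by
    have h1 := sqrt_mul_opt_le hm hB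
    have h2 := mul_le_mul_of_nonneg_left hL (boost_mem hB).1
    linarith
  have hm_sum := (mul_le_mul_of_nonneg_left hbound hm0.le).trans hsum
  constructor
  · rw [one_div_mul_eq_div (m : ℝ), le_div_iff₀ hm0]
    linarith
  · simp only [hopt]
    have : Nonempty (Fin m) := ⟨⟨0, by omega⟩⟩
    obtain ⟨j, _, hj⟩ := Finset.exists_le_of_sum_le (s := Finset.univ)
      (f := fun _ : Fin m => 1 / 16384 * √(m * ((1 + √(m / B)) * B)))
      (g := fun j => (boostedInstance T hB hbid j).regret A) Finset.univ_nonempty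
      (by simpa using! hm_sum)
    exact ⟨j, hj⟩
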